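/- **Setting.** Let $D\subset\mathbb R^d$, $d\ge 1$, be a nonempty bounded open set, and let $V=H^1_0(D)$ be the closure of $C_c^\infty(D)$ in the norm $(\|v\|_{L^2(D)}^2+\|\nabla v\|_{L^2(D)}^2)^{1/2}$. Let $U=[-\tfrac12,\tfrac12]^{\mathbb N}$ with the metric of $\ell^\infty$, let $a_j\in L^\infty(D)$ for $j\ge 0$, and put $a(y)=a(\cdot,y)=a_0+\sum_{j\ge1}y_j a_j$ for $y=(y_1,y_2,\dots)\in U$. Assume that * there are constants $0<a_{\min}<a_{\max}<\infty$ such that, for every $y\in U$, $a_{\min}\le a(x,y)\le a_{\max}$ for almost every $x\in D$; * $\sum_{j\ge1}\|a_j\|_{L^\infty(D)}^p<\infty$ for some $p\in(0,1)$. Consider, for $y\in U$, the variational eigenvalue problem of finding $\lambda\in\mathbb R$ and $0\ne u\in V$ with $$\int_D a(x,y)\,\nabla u\cdot\nabla v\,dx=\lambda\int_D u\,v\,dx\qquad\text{for all }v\in V .$$ **Statement.** For each $y\in U$ the eigenvalues of this problem, repeated according to multiplicity, form a sequence $0<\lambda_1(y)\le\lambda_2(y)\le\cdots$; likewise the eigenvalues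 of the Dirichlet Laplacian on $D$ (the same problem with $a\equiv1$) form a sequence $0<\chi_1\le\chi_2\le\cdots$. Moreover $\sum_{j\ge1}\|a_j\|_{L^\infty(D)}<\infty$, each $\lambda_k$, $k\ge1$, is Lipschitz continuous on $U$ with respect to the $\ell^\infty$ metric, and for all $k\ge1$ and $y,y'\in U$ $$|\lambda_k(y)-\lambda_k(y')|\;\le\;\frac{a_{\max}^2\chi_k^2}{a_{\min}^2\chi_1}\,\|a(y)-a(y')\|_{L^\infty(D)}\;\le\;\frac{a_{\max}^2\chi_k^2}{a_{\min}^2\chi_1}\Big(\sum_{j\ge1}\|a_j\|_{L^\infty(D)}\Big)\|y-y'\|_{\ell^\infty}.$$ -/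

import Mathlib

open MeasureTheory Set
open scoped ENNReal NNReal ContDiff Gradient

noncomputable section

namespace EllipticEVP

/-- The Euclidean space `ℝᵈ`. -/
abbrev Space (d : ℕ) : Type := EuclideanSpace ℝ (Fin d)

/-- The real Hilbert space `L²(D)`. -/
abbrev L2 {d : ℕ} (D : Set (Space d)) : Type := Lp ℝ 2 (volume.restrict D)

/-- The real Hilbert space `L²(D; ℝᵈ)` of square integrable vector fields. -/
abbrev L2Vec {d : ℕ} (D : Set (Space d)) : Type := Lp (Space d) 2 (volume.restrict D)

/-- The Banach space `L^∞(D)`. -/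
abbrev Linf {d : ℕ} (D : Set (Space d)) : Type := Lp ℝ ∞ (volume.restrict D)

/-- The Hilbert space `L²(D) × L²(D; ℝᵈ)` with `‖(u, g)‖² = ‖u‖² + ‖g‖²`; through `u ↦ (u, ∇u)`
the space `H¹(D)` with its usual norm is a closed subspace of it. -/
abbrev H1Ambient {d : ℕ} (D : Set (Space d)) : Type := WithLp 2 (L2 D × L2Vec D)

/-- `φ ∈ C_c^∞(D)`. -/
def IsTestFunction {d : ℕ} (D : Set (Space d)) (φ : Space d → ℝ) : Prop :=
  ContDiff ℝ ∞ φ ∧ HasCompactSupport φ ∧ tsupport φ ⊆ D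

/-- The subspace of all pairs `(φ, ∇φ)` with `φ ∈ C_c^∞(D)`. -/
def testGraph {d : ℕ} (D : Set (Space d)) : Submodule ℝ (H1Ambient D) where
  carrier := {p | ∃ φ : Space d → ℝ, IsTestFunction D φ ∧
    p.fst =ᵐ[volume.restrict D] φ ∧ p.snd =ᵐ[volume.restrict D] ∇ φ}
  zero_mem' := by
    refine ⟨fun _ => 0, ⟨contDiff_const, ?_, ?_⟩, ?_, ?_⟩
    · exact HasCompactSupport.zero
    · have h : tsupport (fun _ : Space d => (0 : ℝ)) = ∅ := tsupport_eq_empty_iff.2 rfl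
      rw [h]
      exact empty_subset D
    · exact Lp.coeFn_zero ℝ 2 _
    · rw [gradient_fun_const']
      exact Lp.coeFn_zero (Space d) 2 _
  add_mem' := by
    rintro p q ⟨φ, ⟨h1, h2, h3⟩, h4, h5⟩ ⟨ψ, ⟨k1, k2, k3⟩, k4, k5⟩
    refine ⟨φ + ψ, ⟨h1.add k1, h2.add k2, ?_⟩, ?_, ?_⟩
    · exact (tsupport_add φ ψ).trans (union_subset h3 k3)
    · exact (Lp.coeFn_add p.fst q.fst).trans (h4.add k4)
    · refine (Lp.coeFn_add p.snd q.snd).trans ((h5.add k5).trans (Filter.Eventually.of_forall ?_))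
      intro x
      have e := fderiv_add (h1.differentiable (by simp) x) (k1.differentiable (by simp) x)
      simp only [Pi.add_apply, gradient, e, map_add]
  smul_mem' := by
    rintro c p ⟨φ, ⟨h1, h2, h3⟩, h4, h5⟩
    refine ⟨c • φ, ⟨h1.const_smul c, h2.smul_left (f := fun _ => c), ?_⟩, ?_, ?_⟩
    · exact (tsupport_smul_subset_right (fun _ => c) φ).trans h3
    · exact (Lp.coeFn_smul c p.fst).trans (h4.const_smul c)
    · refine (Lp.coeFn_smul c p.snd).trans
        ((h5.const_smul c).trans (Filter.Eventually.of_forall ?_))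
      intro x
      have e := fderiv_const_smul (h1.differentiable (by simp) x) c
      simp only [Pi.smul_apply, gradient, e, map_smul]

/-- The Sobolev space `H¹₀(D)`: the closure of `C_c^∞(D)` in the norm
`(‖u‖²_{L²} + ‖∇u‖²_{L²})^{1/2}`.  An element is recorded as the pair of the function and its weak
gradient: a limit `(u, g)` of pairs `(φₙ, ∇φₙ)` inherits the integration by parts formula, so that
`g` is the weak gradient of `u`. -/
def H10 {d : ℕ} (D : Set (Space d)) : Submodule ℝ (H1Ambient D) := (testGraph D).topologicalClosure

/-- The `L²(D)` function underlying an element of `H¹₀(D)`. -/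
def fn {d : ℕ} {D : Set (Space d)} (u : H10 D) : L2 D := (u : H1Ambient D).fst

/-- The weak gradient of an element of `H¹₀(D)`. -/
def grad {d : ℕ} {D : Set (Space d)} (u : H10 D) : L2Vec D := (u : H1Ambient D).snd

theorem integrable_coeff_mul_inner {d : ℕ} {D : Set (Space d)} (a : Linf D) (f g : L2Vec D) :
    Integrable (fun x => a x * inner ℝ (f x) (g x)) (volume.restrict D) := by
  refine (L2.integrable_inner f g).bdd_mul (c := ‖a‖) (Lp.aestronglyMeasurable a) ?_
  have h := ae_le_eLpNormEssSup (f := a) (μ := volume.restrict D)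
  filter_upwards [h] with x hx
  rw [Lp.norm_def, eLpNorm_exponent_top]
  have h2 : eLpNormEssSup a (volume.restrict D) ≠ ⊤ := by
    rw [← eLpNorm_exponent_top]
    exact Lp.eLpNorm_ne_top a
  have h3 := ENNReal.toReal_mono h2 hx
  simpa using h3

/-- The bilinear form `(w, v) ↦ ∫_D a ∇w · ∇v dx` on `H¹₀(D)`. -/
def diffusionForm {d : ℕ} {D : Set (Space d)} (a : Linf D) : LinearMap.BilinForm ℝ (H10 D) :=
  LinearMap.mk₂ ℝ (fun w v => ∫ x in D, a x * inner ℝ (grad w x) (grad v x))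
    (by
      intro w w' v
      rw [← integral_add (integrable_coeff_mul_inner a _ _) (integrable_coeff_mul_inner a _ _)]
      refine integral_congr_ae ?_
      filter_upwards [Lp.coeFn_add (grad w) (grad w')] with x hx
      have e : grad (w + w') = (grad w) + (grad w') := rfl
      rw [e, hx, Pi.add_apply, inner_add_left, mul_add])
    (by
      intro c w v
      rw [smul_eq_mul, ← integral_const_mul]
      refine integral_congr_ae ?_
      filter_upwards [Lp.coeFn_smul c (grad w)] with x hx
      have e : grad (c • w) = c • (grad w) := rfl
      rw [e, hx, Pi.smul_apply, real_inner_smul_left]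
      ring)
    (by
      intro w v v'
      rw [← integral_add (integrable_coeff_mul_inner a _ _) (integrable_coeff_mul_inner a _ _)]
      refine integral_congr_ae ?_
      filter_upwards [Lp.coeFn_add (grad v) (grad v')] with x hx
      have e : grad (v + v') = (grad v) + (grad v') := rfl
      rw [e, hx, Pi.add_apply, inner_add_right, mul_add])
    (by
      intro c w v
      rw [smul_eq_mul, ← integral_const_mul]
      refine integral_congr_ae ?_
      filter_upwards [Lp.coeFn_smul c (grad v)] with x hx
      have e : grad (c • v) = c • (grad v) := rfl
      rw [e, hx, Pi.smul_apply, real_inner_smul_right]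
      ring)

/-- The Dirichlet form `(w, v) ↦ ∫_D ∇w · ∇v dx` on `H¹₀(D)`, i.e. the weak form of the Dirichlet
Laplacian. -/
def dirichletForm {d : ℕ} (D : Set (Space d)) : LinearMap.BilinForm ℝ (H10 D) :=
  LinearMap.mk₂ ℝ (fun w v => ∫ x in D, inner ℝ (grad w x) (grad v x))
    (fun w w' v => inner_add_left (𝕜 := ℝ) (grad w) (grad w') (grad v))
    (fun c w v => real_inner_smul_left (grad w) (grad v) c)
    (fun w v v' => inner_add_right (𝕜 := ℝ) (grad w) (grad v) (grad v'))
    (fun c w v => real_inner_smul_right (grad w) (grad v) c)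

/-- The space of all `u ∈ H¹₀(D)` with `B(u, v) = t ⟨u, v⟩_{L²(D)}` for every `v ∈ H¹₀(D)`; `t` is
an eigenvalue of the variational problem if and only if this space is nonzero. -/
def eigenspace {d : ℕ} {D : Set (Space d)} (B : LinearMap.BilinForm ℝ (H10 D)) (t : ℝ) :
    Submodule ℝ (H10 D) where
  carrier := {u | ∀ v : H10 D, B u v = t * inner ℝ (fn u) (fn v)}
  zero_mem' := by
    intro v
    have e : fn (0 : H10 D) = 0 := rfl
    simp [e]
  add_mem' := by
    intro u u' hu hu' v
    have e : fn (u + u') = (fn u) + (fn u') := rfl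
    rw [map_add, LinearMap.add_apply, hu v, hu' v, e, inner_add_left, mul_add]
  smul_mem' := by
    intro c u hu v
    have e : fn (c • u) = c • (fn u) := rfl
    rw [map_smul, LinearMap.smul_apply, hu v, e, real_inner_smul_left, smul_eq_mul]
    ring

/-- The `k`-th eigenvalue, `k = 1, 2, …`, of the variational problem `B(u, v) = t ⟨u, v⟩`, the
eigenvalues being listed in nondecreasing order and counted with multiplicity: the least `t` such
that the eigenfunctions with eigenvalue at most `t` span a space of dimension at least `k`. -/
def eigenvalue {d : ℕ} {D : Set (Space d)} (B : LinearMap.BilinForm ℝ (H10 D)) (k : ℕ) : ℝ :=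
  sInf {t : ℝ | (k : Cardinal) ≤ Module.rank ℝ ↥(⨆ s ∈ Iic t, eigenspace B s)}

/-- `lam 1 ≤ lam 2 ≤ …` is the list of all eigenvalues of the variational problem
`B(u, v) = t ⟨u, v⟩`, each repeated according to its multiplicity, and they are all positive. -/
structure IsOrderedEigenvalues {d : ℕ} {D : Set (Space d)} (B : LinearMap.BilinForm ℝ (H10 D))
    (lam : ℕ → ℝ) : Prop where
  pos : 0 < lam 1
  mono : ∀ k, 1 ≤ k → lam k ≤ lam (k + 1)
  multiplicity : ∀ t : ℝ,
    {k : ℕ | 1 ≤ k ∧ lam k = t}.encard = Cardinal.toENat (Module.rank ℝ (eigenspace B t))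

/-- The Banach space `ℓ^∞` of bounded real sequences. -/
abbrev SeqInf : Type := lp (fun _ : ℕ => ℝ) ∞

/-- The parameter domain `U = [-1/2, 1/2]^ℕ`, a subset of `ℓ^∞`. The sequence
`(y₁, y₂, …)` is indexed from zero, so that `y j` stands for `y_{j+1}`. -/
def paramDomain : Set SeqInf := {y | ∀ j : ℕ, y j ∈ Icc (-(1 / 2) : ℝ) (1 / 2)}

/-- The coefficient `a(·, y) = a₀ + ∑_{j ≥ 1} y_j a_j ∈ L^∞(D)`. -/
def coeff {d : ℕ} {D : Set (Space d)} (a : ℕ → Linf D) (y : SeqInf) : Linf D :=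
  a 0 + ∑' j : ℕ, y j • a (j + 1)

/-- The standing assumption on the affine coefficient built from `a_j ∈ L^∞(D)`: uniform bounds
`0 < a_min < a_max` and `p`-summability of the norms with `0 < p < 1`. -/
structure CoeffAssumption {d : ℕ} {D : Set (Space d)} (a : ℕ → Linf D) (amin amax p : ℝ) :
    Prop where
  amin_pos : 0 < amin
  amin_lt_amax : amin < amax
  bounds : ∀ y ∈ paramDomain, ∀ᵐ x ∂(volume.restrict D), amin ≤ coeff a y x ∧ coeff a y x ≤ amax
  p_pos : 0 < p
  p_lt_one : p < 1
  summable : Summable fun j : ℕ => ‖a (j + 1)‖ ^ p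

/-- `λ_k(y)`, the `k`-th eigenvalue of
`∫_D a(x, y) ∇u · ∇v dx = λ ∫_D u v dx` for all `v ∈ H¹₀(D)`. -/
def lam {d : ℕ} {D : Set (Space d)} (a : ℕ → Linf D) (k : ℕ) (y : SeqInf) : ℝ :=
  eigenvalue (diffusionForm (coeff a y)) k

/-- `χ_k`, the `k`-th eigenvalue of the Dirichlet Laplacian on `D`. -/
def chi {d : ℕ} (D : Set (Space d)) (k : ℕ) : ℝ := eigenvalue (dirichletForm D) k

end EllipticEVP

end

/-
The eigenvalues of a bounded coercive symmetric form on `H¹₀(D)` are those of the inverse of a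
compact operator, because the inclusion `H¹₀(D) → L²(D)` is compact: a function in `H¹₀(D)` moves
by at most `‖h‖ ‖∇u‖` in `L²` under translation by `h`, so it is uniformly close to its averages
over the cells of a fine grid, of which finitely many meet `D`.

By a dimension count (Courant–Fischer), `B ≤ c B'` implies `λ_k(B) ≤ c λ_k(B')`. Write `a`, `b` for
the two coefficients. Since `∫ |∇u|²` is at most `∫ b |∇u|² / a_min`, the form of `a` is at most
`1 + ‖a - b‖ / a_min` times that of `b`; since `λ_k(b) ≤ a_max χ_k`, this gives
`λ_k(a) - λ_k(b) ≤ (a_max χ_k / a_min) ‖a - b‖`. The stated constant is this one multiplied by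
`a_max χ_k / (a_min χ_1) ≥ 1`.
-/

noncomputable section

namespace EllipticEVP

section CompactOperators

theorem finiteDimensional_of_isCompactOperator_of_le {𝕜 H L : Type*} [NontriviallyNormedField 𝕜]
    [CompleteSpace 𝕜] [NormedAddCommGroup H] [NormedSpace 𝕜 H] [NormedAddCommGroup L]
    [NormedSpace 𝕜 L] {ι : H →L[𝕜] L} (hι : IsCompactOperator ι) (E : Submodule 𝕜 H)
    {C : ℝ} (hE : ∀ u ∈ E, ‖u‖ ≤ C * ‖ι u‖) : FiniteDimensional 𝕜 E := by
  by_contra hfin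
  obtain ⟨R, f, -, hfR, hsep⟩ := exists_seq_norm_le_one_le_norm_sub (𝕜 := 𝕜) hfin
  obtain ⟨K, hK, hKsub⟩ := hι.image_closedBall_subset_compact (f := ι.toLinearMap) R
  have hmem (n : ℕ) : ι (f n) ∈ K := hKsub ⟨f n, by simpa using hfR n, rfl⟩
  obtain ⟨a, -, φ, hφ, hlim⟩ := hK.tendsto_subseq hmem
  have hsep' {m n : ℕ} (hmn : m ≠ n) : 1 ≤ |C| * ‖ι (f m) - ι (f n)‖ :=
    calc 1 ≤ ‖f m - f n‖ := hsep hmn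
      _ ≤ C * ‖ι (f m) - ι (f n)‖ := by simpa using hE _ (f m - f n).2
      _ ≤ |C| * ‖ι (f m) - ι (f n)‖ := by gcongr; exact le_abs_self C
  have hC : 0 < |C| := by
    refine (abs_nonneg C).lt_of_ne fun h0 => ?_
    have := hsep' zero_ne_one
    rw [← h0, zero_mul] at this
    exact this.not_gt one_pos
  obtain ⟨N, hN⟩ := Metric.cauchySeq_iff.1 hlim.cauchySeq (1 / |C|) (by positivity)
  have hclose := hN N le_rfl (N + 1) N.le_succ
  rw [dist_eq_norm, lt_div_iff₀' hC] at hclose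
  exact (hsep' (hφ.injective.ne N.succ_ne_self.symm)).not_gt hclose

theorem isCompactOperator_of_dense_of_finiteDimensional {H L : Type*} [NormedAddCommGroup H]
    [NormedSpace ℝ H] [NormedAddCommGroup L] [InnerProductSpace ℝ L] [CompleteSpace L]
    {T : H →L[ℝ] L} {S : Set H} (hS : Dense S)
    (h : ∀ ε > (0 : ℝ), ∃ W : Submodule ℝ L, FiniteDimensional ℝ W ∧
      ∀ u ∈ S, ∃ w ∈ W, ‖T u - w‖ ≤ ε * ‖u‖) : IsCompactOperator T := by
  have hproj (n : ℕ) : ∃ G : H →L[ℝ] L, IsCompactOperator G ∧ ‖T - G‖ ≤ 1 / ((n : ℝ) + 1) := by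
    obtain ⟨W, hW, happrox⟩ := h (1 / ((n : ℝ) + 1)) Nat.one_div_pos_of_nat
    let G : H →L[ℝ] L := W.starProjection.comp T
    have hdense : S ⊆ {u | ‖(T - G) u‖ ≤ 1 / ((n : ℝ) + 1) * ‖u‖} := fun u hu => by
      obtain ⟨w, hw, hle⟩ := happrox u hu
      refine le_trans ?_ hle
      change ‖T u - W.starProjection (T u)‖ ≤ _
      rw [W.starProjection_minimal]
      exact ciInf_le (f := fun x : W => ‖T u - x‖)
        ⟨0, forall_mem_range.2 fun _ => norm_nonneg _⟩ ⟨w, hw⟩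
    refine ⟨G, ?_, ContinuousLinearMap.opNorm_le_bound _ (by positivity) fun u =>
      closure_minimal hdense (isClosed_le (by fun_prop) (by fun_prop)) (hS u)⟩
    have := FiniteDimensional.proper_real W
    have hincl : IsCompactOperator (W.subtypeL : W → L) :=
      isCompactOperator_of_locallyCompactSpace_rng _
    exact (hincl.comp_clm W.orthogonalProjectionOnto).comp_clm T
  choose G hG hTG using hproj
  refine isCompactOperator_of_tendsto (F := G) (l := Filter.atTop)
    (tendsto_iff_norm_sub_tendsto_zero.2 ?_) (.of_forall hG)
  simp_rw [norm_sub_rev _ T]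
  exact squeeze_zero (fun n => norm_nonneg _) hTG tendsto_one_div_add_atTop_nhds_zero_nat

theorem hasEigenvalue_opNorm {X : Type*} [NormedAddCommGroup X] [InnerProductSpace ℝ X]
    [CompleteSpace X] {S : X →L[ℝ] X} (hS : IsCompactOperator S) (hsymm : S.IsSymmetric)
    (hpos : ∀ f, 0 ≤ inner ℝ (S f) f) (hne : S ≠ 0) :
    Module.End.HasEigenvalue (S : Module.End ℝ X) ‖S‖ := by
  have hrad := S.spectralRadius_eq_nnnorm hsymm.isSelfAdjoint
  have hspec : (spectrum ℝ S).Nonempty := by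
    refine nonempty_iff_ne_empty.2 fun hempty => hne ?_
    rw [spectralRadius, hempty] at hrad
    simpa using hrad.symm
  have : Nontrivial X := by
    obtain ⟨x, hx⟩ := DFunLike.ne_iff.1 hne
    exact ⟨S x, 0, hx⟩
  obtain ⟨μ, hμ, hμrad⟩ := spectrum.exists_nnnorm_eq_spectralRadius_of_nonempty hspec
  have habs : |μ| = ‖S‖ := congrArg NNReal.toReal (ENNReal.coe_injective (hμrad.trans hrad))
  have hμ0 : μ ≠ 0 := by
    rintro rfl
    exact hne (norm_eq_zero.1 (by simpa using habs.symm))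
  have hev := (hS.hasEigenvalue_iff_mem_spectrum hμ0).2 hμ
  have hnonneg : 0 ≤ μ := eigenvalue_nonneg_of_nonneg (𝕜 := ℝ) hev
    fun x => by simpa [real_inner_comm] using hpos x
  rwa [← habs, abs_of_nonneg hnonneg]

theorem opNorm_lt_of_forall_hasEigenvalue_lt {X : Type*} [NormedAddCommGroup X]
    [InnerProductSpace ℝ X] [CompleteSpace X] {S : X →L[ℝ] X} (hS : IsCompactOperator S)
    (hsymm : S.IsSymmetric) (hpos : ∀ f, 0 ≤ inner ℝ (S f) f) {m : ℝ} (hm : 0 < m)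
    (hlt : ∀ μ, Module.End.HasEigenvalue (S : Module.End ℝ X) μ → μ < m) : ‖S‖ < m := by
  rcases eq_or_ne S 0 with rfl | hne
  · rwa [norm_zero]
  · exact hlt _ (hasEigenvalue_opNorm hS hsymm hpos hne)

end CompactOperators

section SpectralSubspaces

open Module

variable {H L : Type*} [NormedAddCommGroup H] [InnerProductSpace ℝ H]
  [NormedAddCommGroup L] [InnerProductSpace ℝ L]

/-- A symmetric, bounded and coercive bilinear form. Boundedness is only asked of the quadratic
form; for a symmetric positive form it passes to the bilinear form by Cauchy–Schwarz. -/
structure IsEnergyForm (B : LinearMap.BilinForm ℝ H) : Prop where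
  symm : ∀ u v, B u v = B v u
  bounded : ∃ C : ℝ, ∀ u, B u u ≤ C * ‖u‖ ^ 2
  coercive : ∃ c : ℝ, 0 < c ∧ ∀ u, c * ‖u‖ ^ 2 ≤ B u u

namespace IsEnergyForm

variable {B : LinearMap.BilinForm ℝ H}

theorem self_nonneg (hB : IsEnergyForm B) (u : H) : 0 ≤ B u u := by
  obtain ⟨c, hc, h⟩ := hB.coercive
  exact le_trans (by positivity) (h u)

theorem self_pos (hB : IsEnergyForm B) {u : H} (hu : u ≠ 0) : 0 < B u u := by
  obtain ⟨c, hc, h⟩ := hB.coercive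
  have : 0 < ‖u‖ := norm_pos_iff.2 hu
  exact lt_of_lt_of_le (by positivity) (h u)

theorem sq_le (hB : IsEnergyForm B) (u v : H) : B u v ^ 2 ≤ B u u * B v v :=
  LinearMap.BilinForm.apply_sq_le_of_symm B hB.self_nonneg ⟨fun u v => hB.symm u v⟩ u v

theorem exists_nonneg_bound (hB : IsEnergyForm B) :
    ∃ C : ℝ, 0 ≤ C ∧ ∀ u v, ‖B u v‖ ≤ C * ‖u‖ * ‖v‖ := by
  obtain ⟨C, h⟩ := hB.bounded
  have hself (u : H) : B u u ≤ |C| * ‖u‖ ^ 2 :=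
    (h u).trans (mul_le_mul_of_nonneg_right (le_abs_self C) (sq_nonneg _))
  refine ⟨|C|, abs_nonneg C, fun u v => abs_le_of_sq_le_sq ?_ (by positivity)⟩
  calc B u v ^ 2 ≤ B u u * B v v := hB.sq_le u v
    _ ≤ (|C| * ‖u‖ ^ 2) * (|C| * ‖v‖ ^ 2) :=
        mul_le_mul (hself u) (hself v) (hB.self_nonneg v) (by positivity)
    _ = (|C| * ‖u‖ * ‖v‖) ^ 2 := by ring

end IsEnergyForm

/-- The eigenspace of the variational problem `B(u, v) = t ⟪ι u, ι v⟫`; for the inclusion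
`ι : H¹₀(D) → L²(D)` this is `eigenspace`. -/
def weakEigenspace (ι : H →L[ℝ] L) (B : LinearMap.BilinForm ℝ H) (t : ℝ) : Submodule ℝ H where
  carrier := {u | ∀ v, B u v = t * inner ℝ (ι u) (ι v)}
  zero_mem' := by intro v; simp
  add_mem' := by
    intro u u' hu hu' v
    rw [map_add, LinearMap.add_apply, hu v, hu' v, map_add, inner_add_left, mul_add]
  smul_mem' := by
    intro c u hu v
    rw [map_smul, LinearMap.smul_apply, hu v, map_smul, real_inner_smul_left, smul_eq_mul]
    ring

/-- The span of the eigenvectors of `B(u, v) = t ⟪ι u, ι v⟫` with eigenvalue at most `t`, the range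
of the spectral projection of `(-∞, t]`. -/
def spectralSubspace (ι : H →L[ℝ] L) (B : LinearMap.BilinForm ℝ H) (t : ℝ) : Submodule ℝ H :=
  ⨆ s ∈ Iic t, weakEigenspace ι B s

variable {ι : H →L[ℝ] L} {B : LinearMap.BilinForm ℝ H}

theorem mem_weakEigenspace {t : ℝ} {u : H} :
    u ∈ weakEigenspace ι B t ↔ ∀ v, B u v = t * inner ℝ (ι u) (ι v) := Iff.rfl

theorem weakEigenspace_le_spectralSubspace {s t : ℝ} (h : s ≤ t) :
    weakEigenspace ι B s ≤ spectralSubspace ι B t :=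
  le_iSup₂_of_le s h le_rfl

theorem spectralSubspace_mono : Monotone (spectralSubspace ι B) := fun _ _ h =>
  iSup₂_le fun _ hr => weakEigenspace_le_spectralSubspace (le_trans hr h)

theorem mem_map_spectralSubspace_orthogonal {t : ℝ} {f : L} :
    f ∈ ((spectralSubspace ι B t).map ι.toLinearMap)ᗮ ↔
      ∀ s ≤ t, ∀ w ∈ weakEigenspace ι B s, inner ℝ (ι w) f = 0 := by
  refine ⟨fun hf s hs w hw =>
    hf _ (Submodule.mem_map_of_mem (weakEigenspace_le_spectralSubspace hs hw)), fun h => ?_⟩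
  have hle : spectralSubspace ι B t ≤ ((ℝ ∙ f)ᗮ).comap ι.toLinearMap :=
    iSup₂_le fun s hs w hw => Submodule.mem_orthogonal_singleton_iff_inner_left.2 (h s hs w hw)
  rintro _ ⟨w, hw, rfl⟩
  exact Submodule.mem_orthogonal_singleton_iff_inner_left.1 (hle hw)

theorem eq_zero_of_mem_weakEigenspace_zero (hB : IsEnergyForm B) {u : H}
    (hu : u ∈ weakEigenspace ι B 0) : u = 0 := by
  by_contra hne
  have h := hB.self_pos hne
  rw [hu u, zero_mul] at h
  exact h.false

theorem eq_zero_of_mem_weakEigenspace (hB : IsEnergyForm B) {t : ℝ} {u : H}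
    (hu : u ∈ weakEigenspace ι B t) (h : ι u = 0) : u = 0 :=
  eq_zero_of_mem_weakEigenspace_zero hB (ι := ι) fun v => by rw [hu v, h, inner_zero_left]; ring

theorem inner_eq_zero_of_mem_weakEigenspace (hB : IsEnergyForm B) {s t : ℝ} (hst : s ≠ t) {u v : H}
    (hu : u ∈ weakEigenspace ι B s) (hv : v ∈ weakEigenspace ι B t) :
    inner ℝ (ι u) (ι v) = 0 := by
  have h : s * inner ℝ (ι u) (ι v) = t * inner ℝ (ι u) (ι v) := by
    rw [← hu v, hB.symm u v, hv u, real_inner_comm]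
  exact (mul_eq_mul_right_iff.1 h).resolve_left hst

theorem disjoint_spectralSubspace_weakEigenspace (hB : IsEnergyForm B) {s t : ℝ} (hst : s < t) :
    Disjoint (spectralSubspace ι B s) (weakEigenspace ι B t) := by
  refine Submodule.disjoint_def.2 fun u hu hu' => eq_zero_of_mem_weakEigenspace hB hu' ?_
  have horth : ι u ∈ ((spectralSubspace ι B s).map ι.toLinearMap)ᗮ :=
    mem_map_spectralSubspace_orthogonal.2 fun r hr w hw =>
      inner_eq_zero_of_mem_weakEigenspace hB (hr.trans_lt hst).ne hw hu'
  exact inner_self_eq_zero.1 (horth _ (Submodule.mem_map_of_mem hu))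

theorem apply_self_sum_weakEigenspace (hB : IsEnergyForm B) (F : Finset ℝ)
    (g : ∀ s, weakEigenspace ι B s) :
    B (∑ s ∈ F, (g s : H)) (∑ s ∈ F, (g s : H)) = ∑ s ∈ F, s * ‖ι (g s)‖ ^ 2 := by
  rw [map_sum B, LinearMap.sum_apply]
  refine Finset.sum_congr rfl fun s hs => ?_
  rw [mem_weakEigenspace.1 (g s).2, map_sum, inner_sum,
    Finset.sum_eq_single_of_mem s hs fun r _ hr =>
      inner_eq_zero_of_mem_weakEigenspace hB hr.symm (g s).2 (g r).2,
    real_inner_self_eq_norm_sq]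

theorem norm_sq_sum_weakEigenspace (hB : IsEnergyForm B) (F : Finset ℝ)
    (g : ∀ s, weakEigenspace ι B s) :
    ‖ι (∑ s ∈ F, (g s : H))‖ ^ 2 = ∑ s ∈ F, ‖ι (g s)‖ ^ 2 := by
  rw [← real_inner_self_eq_norm_sq, map_sum, sum_inner]
  refine Finset.sum_congr rfl fun s hs => ?_
  rw [inner_sum, Finset.sum_eq_single_of_mem s hs fun r _ hr =>
      inner_eq_zero_of_mem_weakEigenspace hB hr.symm (g s).2 (g r).2,
    real_inner_self_eq_norm_sq]

theorem apply_self_le_of_mem_spectralSubspace (hB : IsEnergyForm B) {t : ℝ} {u : H}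
    (hu : u ∈ spectralSubspace ι B t) : B u u ≤ t * ‖ι u‖ ^ 2 := by
  classical
  obtain ⟨f, rfl⟩ := (Submodule.mem_biSup_iff_exists_dfinsupp (· ∈ Iic t) _ _).1 hu
  set g := f.filter (· ∈ Iic t) with hg
  have hsum : DFinsupp.lsum ℕ (fun s => (weakEigenspace ι B s).subtype) g =
      ∑ s ∈ g.support, (g s : H) := by
    simp only [DFinsupp.lsum_apply_apply, DFinsupp.sumAddHom_apply, DFinsupp.sum,
      LinearMap.toAddMonoidHom_coe, Submodule.subtype_apply]
  have hle : ∀ s ∈ g.support, s ≤ t := fun s hs => by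
    rw [hg, DFinsupp.support_filter, Finset.mem_filter] at hs
    exact hs.2
  rw [hsum, apply_self_sum_weakEigenspace hB, norm_sq_sum_weakEigenspace hB, Finset.mul_sum]
  exact Finset.sum_le_sum fun s hs => mul_le_mul_of_nonneg_right (hle s hs) (by positivity)

theorem spectralSubspace_eq_bot (hB : IsEnergyForm B) {t : ℝ} (ht : t ≤ 0) :
    spectralSubspace ι B t = ⊥ := by
  refine (Submodule.eq_bot_iff _).2 fun u hu => ?_
  by_contra hne
  have hnonpos : t * ‖ι u‖ ^ 2 ≤ 0 := mul_nonpos_of_nonpos_of_nonneg ht (by positivity)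
  exact ((hB.self_pos hne).trans_le (apply_self_le_of_mem_spectralSubspace hB hu)).not_ge hnonpos

theorem finiteDimensional_spectralSubspace (hB : IsEnergyForm B) (hι : IsCompactOperator ι)
    (t : ℝ) : FiniteDimensional ℝ (spectralSubspace ι B t) := by
  obtain ⟨c, hc, h⟩ := hB.coercive
  refine finiteDimensional_of_isCompactOperator_of_le hι _ (C := √(t / c)) fun u hu => ?_
  have hsq : ‖u‖ ^ 2 ≤ t / c * ‖ι u‖ ^ 2 := by
    rw [div_mul_eq_mul_div, le_div_iff₀ hc]
    linarith [h u, apply_self_le_of_mem_spectralSubspace hB hu]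
  calc ‖u‖ = √(‖u‖ ^ 2) := (Real.sqrt_sq (norm_nonneg _)).symm
    _ ≤ √(t / c * ‖ι u‖ ^ 2) := Real.sqrt_le_sqrt hsq
    _ = √(t / c) * ‖ι u‖ := by
        rw [Real.sqrt_mul' _ (by positivity), Real.sqrt_sq (norm_nonneg _)]

theorem finrank_spectralSubspace_mono (hB : IsEnergyForm B) (hι : IsCompactOperator ι) :
    Monotone fun t => finrank ℝ (spectralSubspace ι B t) := fun _ t hst =>
  have := finiteDimensional_spectralSubspace hB hι t
  Submodule.finrank_mono (spectralSubspace_mono hst)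

theorem weakEigenspace_eq_bot_of_finrank_le (hB : IsEnergyForm B) (hι : IsCompactOperator ι)
    {s r : ℝ} (hsr : s < r)
    (h : finrank ℝ (spectralSubspace ι B r) ≤ finrank ℝ (spectralSubspace ι B s)) :
    weakEigenspace ι B r = ⊥ := by
  have := finiteDimensional_spectralSubspace hB hι r
  have heq := Submodule.eq_of_le_of_finrank_le (spectralSubspace_mono (ι := ι) (B := B) hsr.le) h
  have hdisj := disjoint_spectralSubspace_weakEigenspace (ι := ι) hB hsr
  rw [heq] at hdisj
  exact hdisj.eq_bot_of_ge (weakEigenspace_le_spectralSubspace le_rfl)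

theorem exists_gt_spectralSubspace_eq (hB : IsEnergyForm B) (hι : IsCompactOperator ι) (t : ℝ) :
    ∃ r > t, spectralSubspace ι B r = spectralSubspace ι B t := by
  have hmono := finrank_spectralSubspace_mono hB hι
  obtain ⟨_, ⟨r, hrt, rfl⟩, hmin⟩ := exists_minimal_of_wellFoundedLT (fun n => n ∈
    (fun s => finrank ℝ (spectralSubspace ι B s)) '' Ioi t) ⟨_, t + 1, by simp, rfl⟩
  refine ⟨r, hrt, le_antisymm (iSup₂_le fun s hs => ?_) (spectralSubspace_mono (le_of_lt hrt))⟩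
  rcases le_or_gt s t with hst | hst
  · exact weakEigenspace_le_spectralSubspace hst
  obtain ⟨q, htq, hqs⟩ := exists_between hst
  have hqr := hmin ⟨q, htq, rfl⟩ (hmono (hqs.le.trans hs))
  rw [weakEigenspace_eq_bot_of_finrank_le hB hι hqs ((hmono hs).trans hqr)]
  exact bot_le

theorem exists_lt_forall_weakEigenspace_le (hB : IsEnergyForm B) (hι : IsCompactOperator ι)
    (t : ℝ) : ∃ r < t, ∀ s < t, weakEigenspace ι B s ≤ spectralSubspace ι B r := by
  have hmono := finrank_spectralSubspace_mono hB hι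
  obtain ⟨_, ⟨r, hrt, rfl⟩, hmax⟩ := BddAbove.exists_isGreatest_of_nonempty
    (S := (fun s => finrank ℝ (spectralSubspace ι B s)) '' Iio t)
    ⟨_, by rintro _ ⟨s, hs, rfl⟩; exact hmono (le_of_lt hs)⟩ ⟨_, t - 1, by simp, rfl⟩
  refine ⟨r, hrt, fun s hst => ?_⟩
  rcases le_or_gt s r with hsr | hrs
  · exact weakEigenspace_le_spectralSubspace hsr
  · rw [weakEigenspace_eq_bot_of_finrank_le hB hι hrs (hmax ⟨s, hst, rfl⟩)]
    exact bot_le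

theorem exists_lt_forall_spectralSubspace_eq (hB : IsEnergyForm B) (hι : IsCompactOperator ι)
    (t : ℝ) : ∃ r < t, (∀ s ∈ Ico r t, spectralSubspace ι B s = spectralSubspace ι B r) ∧
      spectralSubspace ι B t = spectralSubspace ι B r ⊔ weakEigenspace ι B t := by
  obtain ⟨r, hrt, hle⟩ := exists_lt_forall_weakEigenspace_le hB hι t
  refine ⟨r, hrt, fun s hs => ?_, le_antisymm (iSup₂_le fun q hq => ?_) ?_⟩
  · exact le_antisymm (iSup₂_le fun q hq => hle q (lt_of_le_of_lt hq hs.2))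
      (spectralSubspace_mono hs.1)
  · rcases eq_or_lt_of_le (show q ≤ t from hq) with rfl | h
    · exact le_sup_right
    · exact (hle q h).trans le_sup_left
  · exact sup_le (spectralSubspace_mono hrt.le) (weakEigenspace_le_spectralSubspace le_rfl)

end SpectralSubspaces

section CourantFischer

open Module

variable {H L : Type*} [NormedAddCommGroup H] [InnerProductSpace ℝ H]
  [NormedAddCommGroup L] [InnerProductSpace ℝ L] {ι : H →L[ℝ] L} {B : LinearMap.BilinForm ℝ H}

theorem IsEnergyForm.exists_solutionOperator [CompleteSpace H] [CompleteSpace L]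
    (hB : IsEnergyForm B) (ι : H →L[ℝ] L) :
    ∃ R : L →L[ℝ] H, ∀ f v, B (R f) v = inner ℝ f (ι v) := by
  obtain ⟨C, -, hC⟩ := hB.exists_nonneg_bound
  obtain ⟨c, hc, hcoer⟩ := hB.coercive
  have hco : IsCoercive (B.mkContinuous₂ C hC) :=
    ⟨c, hc, fun u => by simpa [sq, mul_assoc] using hcoer u⟩
  let S := hco.continuousLinearEquivOfBilin.symm
  have hS (g v : H) : B (S g) v = inner ℝ g v := by
    simpa [S] using (hco.continuousLinearEquivOfBilin_apply (S g) v).symm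
  refine ⟨(S : H →L[ℝ] H).comp (ContinuousLinearMap.adjoint ι), fun f v => ?_⟩
  exact (hS _ v).trans (ContinuousLinearMap.adjoint_inner_left ι v f)

section SolutionOperator

variable {R : L →L[ℝ] H}

theorem inner_solutionOperator (hB : IsEnergyForm B) (hR : ∀ f v, B (R f) v = inner ℝ f (ι v))
    (f g : L) : inner ℝ (ι (R f)) g = B (R f) (R g) := by
  rw [hB.symm, hR, real_inner_comm]

theorem solutionOperator_mem_weakEigenspace (hR : ∀ f v, B (R f) v = inner ℝ f (ι v)) {μ : ℝ}
    (hμ : μ ≠ 0) {f : L} (hf : ι (R f) = μ • f) : R f ∈ weakEigenspace ι B μ⁻¹ := fun v => by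
  rw [hR, hf, real_inner_smul_left, inv_mul_cancel_left₀ hμ]

theorem solutionOperator_mem_orthogonal (hB : IsEnergyForm B)
    (hR : ∀ f v, B (R f) v = inner ℝ f (ι v)) {t : ℝ} {f : L}
    (hf : f ∈ ((spectralSubspace ι B t).map ι.toLinearMap)ᗮ) :
    ι (R f) ∈ ((spectralSubspace ι B t).map ι.toLinearMap)ᗮ := by
  rw [mem_map_spectralSubspace_orthogonal] at hf ⊢
  intro s hs w hw
  have h : s * inner ℝ (ι w) (ι (R f)) = 0 := by
    rw [← hw (R f), hB.symm, hR, real_inner_comm, hf s hs w hw]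
  rcases mul_eq_zero.1 h with rfl | h
  · rw [eq_zero_of_mem_weakEigenspace_zero hB hw, map_zero, inner_zero_left]
  · exact h

theorem exists_inner_solutionOperator_le [CompleteSpace L] (hB : IsEnergyForm B)
    (hι : IsCompactOperator ι) (hR : ∀ f v, B (R f) v = inner ℝ f (ι v)) {t : ℝ} (ht : 0 < t) :
    ∃ r < t⁻¹, ∀ f ∈ ((spectralSubspace ι B t).map ι.toLinearMap)ᗮ,
      inner ℝ (ι (R f)) f ≤ r * ‖f‖ ^ 2 := by
  set X := ((spectralSubspace ι B t).map ι.toLinearMap)ᗮ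
  have hinv : ∀ f ∈ X, ι.comp R f ∈ X := fun f hf => solutionOperator_mem_orthogonal hB hR hf
  have hsymm : (ι.comp R).IsSymmetric := fun f g => by
    change inner ℝ (ι (R f)) g = inner ℝ f (ι (R g))
    rw [inner_solutionOperator hB hR, real_inner_comm, inner_solutionOperator hB hR, hB.symm]
  let T : X →L[ℝ] X := (ι.comp R).restrict hinv
  have hTpos (f : X) : 0 ≤ inner ℝ (T f) f :=
    (hB.self_nonneg _).trans_eq (inner_solutionOperator hB hR f f).symm
  have hTlt : ∀ μ, End.HasEigenvalue (T : End ℝ X) μ → μ < t⁻¹ := fun μ hμ => by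
    by_contra! hle
    have hμ0 : μ ≠ 0 := ((inv_pos.2 ht).trans_le hle).ne'
    obtain ⟨f, hf⟩ := hμ.exists_hasEigenvector
    have hTf : ι (R f) = μ • (f : L) := congrArg Subtype.val hf.apply_eq_smul
    have horth : inner ℝ (ι (R f)) (f : L) = 0 := mem_map_spectralSubspace_orthogonal.1 f.2 _
      (inv_le_of_inv_le₀ ht hle) _ (solutionOperator_mem_weakEigenspace hR hμ0 hTf)
    rw [hTf, real_inner_smul_left] at horth
    exact hf.2 (Subtype.ext (inner_self_eq_zero.1 ((mul_eq_zero.1 horth).resolve_left hμ0)))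
  refine ⟨‖T‖, opNorm_lt_of_forall_hasEigenvalue_lt ((hι.comp_clm R).restrict' hinv)
    (hsymm.restrict_invariant hinv) hTpos (inv_pos.2 ht) hTlt, fun f hf => ?_⟩
  calc inner ℝ (ι (R f)) f ≤ ‖T ⟨f, hf⟩‖ * ‖f‖ := real_inner_le_norm _ _
    _ ≤ ‖T‖ * ‖f‖ * ‖f‖ := by gcongr; exact T.le_opNorm ⟨f, hf⟩
    _ = ‖T‖ * ‖f‖ ^ 2 := by ring

end SolutionOperator

variable [CompleteSpace H] [CompleteSpace L]

theorem lt_apply_self_of_mem_orthogonal (hB : IsEnergyForm B) (hι : IsCompactOperator ι) {t : ℝ}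
    {u : H} (hu : u ≠ 0) (horth : ι u ∈ ((spectralSubspace ι B t).map ι.toLinearMap)ᗮ) :
    t * ‖ι u‖ ^ 2 < B u u := by
  have hBu := hB.self_pos hu
  rcases le_or_gt t 0 with ht | ht
  · exact (mul_nonpos_of_nonpos_of_nonneg ht (by positivity)).trans_lt hBu
  rcases eq_or_ne (ι u) 0 with h0 | h0
  · simpa [h0] using hBu
  obtain ⟨R, hR⟩ := hB.exists_solutionOperator ι
  obtain ⟨r, hr, hle⟩ := exists_inner_solutionOperator_le hB hι hR ht
  have hpos : 0 < ‖ι u‖ ^ 2 := by have := norm_pos_iff.2 h0; positivity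
  -- Cauchy–Schwarz for `B` at `R (ι u)` and `u`
  have hsq : ‖ι u‖ ^ 2 * ‖ι u‖ ^ 2 ≤ ‖ι u‖ ^ 2 * (r * B u u) :=
    calc ‖ι u‖ ^ 2 * ‖ι u‖ ^ 2 = B (R (ι u)) u ^ 2 := by
          rw [hR, real_inner_self_eq_norm_sq, sq (‖ι u‖ ^ 2)]
      _ ≤ B (R (ι u)) (R (ι u)) * B u u := hB.sq_le _ _
      _ ≤ r * ‖ι u‖ ^ 2 * B u u := by
          rw [← inner_solutionOperator hB hR]
          exact mul_le_mul_of_nonneg_right (hle _ horth) hBu.le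
      _ = ‖ι u‖ ^ 2 * (r * B u u) := by ring
  calc t * ‖ι u‖ ^ 2 ≤ t * (r * B u u) := by gcongr; exact le_of_mul_le_mul_left hsq hpos
    _ < t * (t⁻¹ * B u u) := by gcongr
    _ = B u u := mul_inv_cancel_left₀ ht.ne' _

theorem finrank_le_finrank_spectralSubspace (hB : IsEnergyForm B) (hι : IsCompactOperator ι)
    {t : ℝ} (S : Submodule ℝ H) [FiniteDimensional ℝ S]
    (hS : ∀ u ∈ S, B u u ≤ t * ‖ι u‖ ^ 2) :
    finrank ℝ S ≤ finrank ℝ (spectralSubspace ι B t) := by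
  have := finiteDimensional_spectralSubspace hB hι t
  set P := (spectralSubspace ι B t).map ι.toLinearMap
  let φ : S →ₗ[ℝ] P := P.orthogonalProjectionOnto.toLinearMap.comp (ι.toLinearMap.comp S.subtype)
  have hφ : Function.Injective φ := by
    refine (injective_iff_map_eq_zero φ).2 fun u hu => ?_
    by_contra hne
    have horth : ι u ∈ Pᗮ := Submodule.orthogonalProjectionOnto_eq_zero_iff.1 hu
    exact (lt_apply_self_of_mem_orthogonal hB hι (u := u) (by simpa using hne) horth).not_ge
      (hS u u.2)
  exact (LinearMap.finrank_le_finrank_of_injective hφ).trans (Submodule.finrank_map_le _ _)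

theorem exists_finrank_eq_forall_norm_le {H L : Type*} [NormedAddCommGroup H] [NormedSpace ℝ H]
    [NormedAddCommGroup L] [NormedSpace ℝ L] (ι : H →ₗ[ℝ] L) (hι : ¬ FiniteDimensional ℝ ι.range)
    (k : ℕ) : ∃ S : Submodule ℝ H, FiniteDimensional ℝ S ∧ finrank ℝ S = k ∧
      ∃ K : ℝ, ∀ u ∈ S, ‖u‖ ≤ K * ‖ι u‖ := by
  obtain ⟨f, hf⟩ : ∃ f : Fin k → ι.range, LinearIndependent ℝ f :=
    exists_linearIndependent_of_le_rank <| Cardinal.natCast_lt_aleph0.le.trans <|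
      not_lt.1 fun h => hι (Module.rank_lt_aleph0_iff.1 h)
  obtain ⟨j, hj⟩ := ι.rangeRestrict.exists_rightInverse_of_surjective ι.range_rangeRestrict
  have hιj (w : ι.range) : ι (j w) = w := congrArg Subtype.val (LinearMap.congr_fun hj w)
  have hjinj : Function.Injective j := fun w w' h => Subtype.ext (by rw [← hιj, h, hιj])
  let W := Submodule.span ℝ (range f)
  have hW : FiniteDimensional ℝ W := .span_of_finite ℝ (finite_range f)
  refine ⟨W.map j, inferInstance, ?_, ‖(j.comp W.subtype).toContinuousLinearMap‖, ?_⟩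
  · rw [← (Submodule.equivMapOfInjective j hjinj W).finrank_eq, finrank_span_eq_card hf,
      Fintype.card_fin]
  · rintro _ ⟨w, hw, rfl⟩
    rw [hιj]
    exact (j.comp W.subtype).toContinuousLinearMap.le_opNorm ⟨w, hw⟩

theorem exists_le_finrank_spectralSubspace (hB : IsEnergyForm B) (hι : IsCompactOperator ι)
    (hinf : ¬ FiniteDimensional ℝ ι.range) (k : ℕ) :
    ∃ t, k ≤ finrank ℝ (spectralSubspace ι B t) := by
  obtain ⟨S, hfin, hrank, K, hK⟩ := exists_finrank_eq_forall_norm_le ι.toLinearMap hinf k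
  obtain ⟨C, hC, hBC⟩ := hB.exists_nonneg_bound
  refine ⟨C * K ^ 2, hrank.symm.trans_le ?_⟩
  refine finrank_le_finrank_spectralSubspace hB hι S fun u hu => ?_
  calc B u u ≤ C * ‖u‖ * ‖u‖ := (le_abs_self _).trans (hBC u u)
    _ = C * ‖u‖ ^ 2 := by ring
    _ ≤ C * (K * ‖ι u‖) ^ 2 := by gcongr; exact hK u hu
    _ = C * K ^ 2 * ‖ι u‖ ^ 2 := by ring

end CourantFischer

section WeakEigenvalues

open Module

variable {H L : Type*} [NormedAddCommGroup H] [InnerProductSpace ℝ H]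
  [NormedAddCommGroup L] [InnerProductSpace ℝ L]

/-- The `k`-th eigenvalue, `k = 1, 2, …`, of `B(u, v) = t ⟪ι u, ι v⟫` counted with multiplicity;
for the inclusion `ι : H¹₀(D) → L²(D)` this is `eigenvalue`. -/
def weakEigenvalue (ι : H →L[ℝ] L) (B : LinearMap.BilinForm ℝ H) (k : ℕ) : ℝ :=
  sInf {t : ℝ | (k : Cardinal) ≤ Module.rank ℝ (spectralSubspace ι B t)}

variable {ι : H →L[ℝ] L} {B : LinearMap.BilinForm ℝ H}

theorem weakEigenvalue_eq_sInf (hB : IsEnergyForm B) (hι : IsCompactOperator ι) (k : ℕ) :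
    weakEigenvalue ι B k = sInf {t : ℝ | k ≤ finrank ℝ (spectralSubspace ι B t)} := by
  refine congrArg sInf (Set.ext fun t => ?_)
  have := finiteDimensional_spectralSubspace hB hι t
  rw [mem_ofPred_eq, mem_ofPred_eq, ← finrank_eq_rank, Nat.cast_le]

variable [CompleteSpace H] [CompleteSpace L]

theorem weakEigenvalue_le_iff (hB : IsEnergyForm B) (hι : IsCompactOperator ι)
    (hinf : ¬ FiniteDimensional ℝ ι.range) {k : ℕ} (hk : 1 ≤ k) {t : ℝ} :
    weakEigenvalue ι B k ≤ t ↔ k ≤ finrank ℝ (spectralSubspace ι B t) := by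
  have hmono := finrank_spectralSubspace_mono hB hι
  have hbdd : BddBelow {t : ℝ | k ≤ finrank ℝ (spectralSubspace ι B t)} := by
    refine ⟨0, fun s hs => ?_⟩
    by_contra! h
    rw [mem_ofPred_eq, spectralSubspace_eq_bot hB h.le, finrank_bot] at hs
    omega
  refine ⟨fun h => ?_, fun h => weakEigenvalue_eq_sInf hB hι k ▸ csInf_le hbdd h⟩
  obtain ⟨r, hr, heq⟩ := exists_gt_spectralSubspace_eq hB hι (weakEigenvalue ι B k)
  rw [gt_iff_lt, weakEigenvalue_eq_sInf hB hι] at hr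
  obtain ⟨s, hs, hsr⟩ :=
    exists_lt_of_csInf_lt (exists_le_finrank_spectralSubspace hB hι hinf k) hr
  calc k ≤ finrank ℝ (spectralSubspace ι B r) := le_trans hs (hmono hsr.le)
    _ = finrank ℝ (spectralSubspace ι B (weakEigenvalue ι B k)) := by rw [heq]
    _ ≤ finrank ℝ (spectralSubspace ι B t) := hmono h

theorem weakEigenvalue_pos (hB : IsEnergyForm B) (hι : IsCompactOperator ι)
    (hinf : ¬ FiniteDimensional ℝ ι.range) {k : ℕ} (hk : 1 ≤ k) : 0 < weakEigenvalue ι B k := by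
  by_contra! h
  rw [weakEigenvalue_le_iff hB hι hinf hk, spectralSubspace_eq_bot hB le_rfl, finrank_bot] at h
  omega

theorem weakEigenvalue_mono (hB : IsEnergyForm B) (hι : IsCompactOperator ι)
    (hinf : ¬ FiniteDimensional ℝ ι.range) {j k : ℕ} (hj : 1 ≤ j) (hjk : j ≤ k) :
    weakEigenvalue ι B j ≤ weakEigenvalue ι B k :=
  (weakEigenvalue_le_iff hB hι hinf hj).2
    (hjk.trans ((weakEigenvalue_le_iff hB hι hinf (hj.trans hjk)).1 le_rfl))

theorem weakEigenvalue_eq_iff (hB : IsEnergyForm B) (hι : IsCompactOperator ι)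
    (hinf : ¬ FiniteDimensional ℝ ι.range) {r t : ℝ} (hrt : r < t)
    (hconst : ∀ s ∈ Ico r t, spectralSubspace ι B s = spectralSubspace ι B r) {k : ℕ}
    (hk : 1 ≤ k) : weakEigenvalue ι B k = t ↔
      k ∈ Ioc (finrank ℝ (spectralSubspace ι B r)) (finrank ℝ (spectralSubspace ι B t)) := by
  have hle {s : ℝ} := weakEigenvalue_le_iff hB hι hinf hk (t := s)
  refine ⟨?_, fun ⟨hlt, hkt⟩ => (hle.2 hkt).antisymm (le_of_not_gt fun h => ?_)⟩
  · rintro rfl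
    exact ⟨not_le.1 fun h => hrt.not_ge (hle.2 h), hle.1 le_rfl⟩
  · have hmax := hle.1 (le_max_right r (weakEigenvalue ι B k))
    rw [hconst _ ⟨le_max_left _ _, max_lt hrt h⟩] at hmax
    exact hlt.not_ge hmax

theorem encard_weakEigenvalue_eq (hB : IsEnergyForm B) (hι : IsCompactOperator ι)
    (hinf : ¬ FiniteDimensional ℝ ι.range) (t : ℝ) :
    {k : ℕ | 1 ≤ k ∧ weakEigenvalue ι B k = t}.encard =
      Cardinal.toENat (Module.rank ℝ (weakEigenspace ι B t)) := by
  obtain ⟨r, hrt, hconst, hsup⟩ := exists_lt_forall_spectralSubspace_eq hB hι t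
  have hfr := finiteDimensional_spectralSubspace hB hι r
  have hft := finiteDimensional_spectralSubspace hB hι t
  have hfe : FiniteDimensional ℝ (weakEigenspace ι B t) :=
    Submodule.finiteDimensional_of_le (weakEigenspace_le_spectralSubspace le_rfl)
  have hdim : finrank ℝ (spectralSubspace ι B t) =
      finrank ℝ (spectralSubspace ι B r) + finrank ℝ (weakEigenspace ι B t) := by
    rw [← Submodule.finrank_sup_add_finrank_inf_eq, ← hsup,
      (disjoint_spectralSubspace_weakEigenspace hB hrt).eq_bot, finrank_bot, add_zero]
  have hset : {k : ℕ | 1 ≤ k ∧ weakEigenvalue ι B k = t} =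
      Finset.Ioc (finrank ℝ (spectralSubspace ι B r)) (finrank ℝ (spectralSubspace ι B t)) := by
    ext k
    rw [mem_ofPred_eq, Finset.coe_Ioc]
    exact ⟨fun ⟨hk, h⟩ => (weakEigenvalue_eq_iff hB hι hinf hrt hconst hk).1 h, fun h =>
      have hk : 1 ≤ k := by have := h.1; omega
      ⟨hk, (weakEigenvalue_eq_iff hB hι hinf hrt hconst hk).2 h⟩⟩
  rw [hset, Set.encard_coe_eq_coe_finsetCard, Nat.card_Ioc, hdim, Nat.add_sub_cancel_left,
    ← finrank_eq_rank, Cardinal.toENat_nat]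

theorem weakEigenvalue_le_mul {B' : LinearMap.BilinForm ℝ H} (hB : IsEnergyForm B)
    (hB' : IsEnergyForm B') (hι : IsCompactOperator ι) (hinf : ¬ FiniteDimensional ℝ ι.range)
    {k : ℕ} (hk : 1 ≤ k) {c : ℝ} (hc : 0 ≤ c) (hle : ∀ u, B u u ≤ c * B' u u) :
    weakEigenvalue ι B k ≤ c * weakEigenvalue ι B' k := by
  rw [weakEigenvalue_le_iff hB hι hinf hk]
  refine ((weakEigenvalue_le_iff hB' hι hinf hk).1 le_rfl).trans ?_
  have := finiteDimensional_spectralSubspace hB' hι (weakEigenvalue ι B' k)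
  refine finrank_le_finrank_spectralSubspace hB hι _ fun u hu => ?_
  calc B u u ≤ c * B' u u := hle u
    _ ≤ c * (weakEigenvalue ι B' k * ‖ι u‖ ^ 2) := by
        gcongr
        exact apply_self_le_of_mem_spectralSubspace hB' hu
    _ = c * weakEigenvalue ι B' k * ‖ι u‖ ^ 2 := (mul_assoc _ _ _).symm

end WeakEigenvalues

section TranslationEstimate

theorem sq_lintegral_le {α : Type*} [MeasurableSpace α] (μ : Measure α) {f : α → ℝ≥0∞}
    (hf : AEMeasurable f μ) : (∫⁻ x, f x ∂μ) ^ 2 ≤ μ univ * ∫⁻ x, f x ^ 2 ∂μ := by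
  have h := ENNReal.lintegral_mul_le_Lp_mul_Lq μ Real.HolderConjugate.two_two hf
    (aemeasurable_const (b := (1 : ℝ≥0∞)))
  simp only [Pi.mul_apply, mul_one, ENNReal.one_rpow, lintegral_const, one_mul] at h
  calc (∫⁻ x, f x ∂μ) ^ 2
      ≤ ((∫⁻ x, f x ^ (2 : ℝ) ∂μ) ^ (1 / 2 : ℝ) * μ univ ^ (1 / 2 : ℝ)) ^ 2 := by gcongr
    _ = μ univ * ∫⁻ x, f x ^ 2 ∂μ := by
        rw [mul_pow, ← ENNReal.rpow_natCast, ← ENNReal.rpow_natCast, ← ENNReal.rpow_mul,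
          ← ENNReal.rpow_mul]
        norm_num [mul_comm]

variable {E F : Type*} [NormedAddCommGroup E] [NormedSpace ℝ E] [NormedAddCommGroup F]
  [NormedSpace ℝ F] [CompleteSpace F] {f : E → F}

theorem enorm_sub_sq_le_lintegral_fderiv (hf : ContDiff ℝ 1 f) (x z : E) :
    ‖f (x + z) - f x‖ₑ ^ 2 ≤
      ‖z‖ₑ ^ 2 * ∫⁻ t in Ioc (0 : ℝ) 1, ‖fderiv ℝ f (x + t • z)‖ₑ ^ 2 := by
  have hf' : Continuous fun t : ℝ => fderiv ℝ f (x + t • z) :=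
    (hf.continuous_fderiv one_ne_zero).comp (by fun_prop)
  have hderiv (t : ℝ) : HasDerivAt (fun t : ℝ => f (x + t • z)) (fderiv ℝ f (x + t • z) z) t := by
    have hline : HasDerivAt (fun t : ℝ => x + t • z) z t := by
      simpa using ((hasDerivAt_id t).smul_const z).const_add x
    exact ((hf.differentiable one_ne_zero _).hasFDerivAt).comp_hasDerivAt t hline
  have hftc : ∫ t in Ioc (0 : ℝ) 1, fderiv ℝ f (x + t • z) z = f (x + z) - f x := by
    simpa [intervalIntegral.integral_of_le zero_le_one] using
      intervalIntegral.integral_eq_sub_of_hasDerivAt (a := 0) (b := 1) (fun t _ => hderiv t)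
        ((hf'.clm_apply continuous_const).intervalIntegrable 0 1)
  have hm : Measurable fun t : ℝ => ‖fderiv ℝ f (x + t • z)‖ₑ := hf'.enorm.measurable
  calc ‖f (x + z) - f x‖ₑ ^ 2
      ≤ (∫⁻ t in Ioc (0 : ℝ) 1, ‖fderiv ℝ f (x + t • z)‖ₑ * ‖z‖ₑ) ^ 2 := by
        rw [← hftc]
        gcongr
        exact (enorm_integral_le_lintegral_enorm _).trans
          (lintegral_mono fun t => ContinuousLinearMap.le_opENorm _ z)
    _ = ‖z‖ₑ ^ 2 * (∫⁻ t in Ioc (0 : ℝ) 1, ‖fderiv ℝ f (x + t • z)‖ₑ) ^ 2 := by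
        rw [lintegral_mul_const _ hm, mul_pow, mul_comm]
    _ ≤ ‖z‖ₑ ^ 2 * ∫⁻ t in Ioc (0 : ℝ) 1, ‖fderiv ℝ f (x + t • z)‖ₑ ^ 2 := by
        gcongr
        simpa using sq_lintegral_le (volume.restrict (Ioc (0 : ℝ) 1)) hm.aemeasurable

variable [MeasurableSpace E] [BorelSpace E] {μ : Measure E} [SFinite μ]
  [μ.IsAddRightInvariant]

theorem lintegral_enorm_translate_sub_sq_le (hf : ContDiff ℝ 1 f) (z : E) :
    ∫⁻ x, ‖f (x + z) - f x‖ₑ ^ 2 ∂μ ≤ ‖z‖ₑ ^ 2 * ∫⁻ x, ‖fderiv ℝ f x‖ₑ ^ 2 ∂μ := by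
  have hc : Continuous fun q : E × ℝ => ‖fderiv ℝ f (q.1 + q.2 • z)‖ₑ ^ 2 :=
    (ENNReal.continuous_pow 2).comp ((hf.continuous_fderiv one_ne_zero).comp (by fun_prop)).enorm
  have htranslate (t : ℝ) :
      ∫⁻ x, ‖fderiv ℝ f (x + t • z)‖ₑ ^ 2 ∂μ = ∫⁻ x, ‖fderiv ℝ f x‖ₑ ^ 2 ∂μ :=
    lintegral_add_right_eq_self (fun x => ‖fderiv ℝ f x‖ₑ ^ 2) (t • z)
  calc ∫⁻ x, ‖f (x + z) - f x‖ₑ ^ 2 ∂μ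
      ≤ ∫⁻ x, ‖z‖ₑ ^ 2 * (∫⁻ t in Ioc (0 : ℝ) 1, ‖fderiv ℝ f (x + t • z)‖ₑ ^ 2) ∂μ :=
        lintegral_mono fun x => enorm_sub_sq_le_lintegral_fderiv hf x z
    _ = ‖z‖ₑ ^ 2 * ∫⁻ t in Ioc (0 : ℝ) 1, ∫⁻ x, ‖fderiv ℝ f (x + t • z)‖ₑ ^ 2 ∂μ := by
        rw [lintegral_const_mul _ hc.measurable.lintegral_prod_right,
          lintegral_lintegral_swap hc.measurable.aemeasurable]
    _ = ‖z‖ₑ ^ 2 * ∫⁻ x, ‖fderiv ℝ f x‖ₑ ^ 2 ∂μ := by simp [htranslate]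

theorem exists_lintegral_enorm_sq_le_lintegral_fderiv [Nontrivial E] (μ : Measure E) [SFinite μ]
    [μ.IsAddRightInvariant] {s : Set E} (hs : Bornology.IsBounded s) :
    ∃ C : ℝ≥0, ∀ f : E → F, ContDiff ℝ 1 f → (∀ x ∉ s, f x = 0) →
      ∫⁻ x, ‖f x‖ₑ ^ 2 ∂μ ≤ C ^ 2 * ∫⁻ x, ‖fderiv ℝ f x‖ₑ ^ 2 ∂μ := by
  obtain ⟨r, hr⟩ := hs.subset_closedBall 0
  obtain ⟨z, hz⟩ := NormedSpace.exists_lt_norm ℝ E (r + r)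
  have hshift {x : E} (hx : x ∈ s) : x + z ∉ s := fun hxz => by
    have hx' : ‖x‖ ≤ r := by simpa using hr hx
    have hxz' : ‖x + z‖ ≤ r := by simpa using hr hxz
    have hsub : ‖z‖ ≤ ‖x + z‖ + ‖x‖ := by simpa using norm_sub_le (x + z) x
    linarith
  refine ⟨‖z‖₊, fun f hf hfs => ?_⟩
  refine le_trans (lintegral_mono fun x => ?_) (lintegral_enorm_translate_sub_sq_le hf z)
  by_cases hx : x ∈ s
  · simp [hfs _ (hshift hx)]
  · simp [hfs _ hx]

end TranslationEstimate

section Averages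

theorem enorm_sub_setAverage_sq_le {α F : Type*} [MeasurableSpace α] {μ : Measure α}
    [NormedAddCommGroup F] [NormedSpace ℝ F] [CompleteSpace F] {f : α → F} {s : Set α}
    (hf : IntegrableOn f s μ) (h0 : μ s ≠ 0) (ht : μ s ≠ ⊤) (x : α) :
    ‖f x - ⨍ y in s, f y ∂μ‖ₑ ^ 2 ≤ (μ s)⁻¹ * ∫⁻ y in s, ‖f x - f y‖ₑ ^ 2 ∂μ := by
  have hc : IntegrableOn (fun _ => f x) s μ := integrableOn_const ht
  have hsub : f x - ⨍ y in s, f y ∂μ = (μ.real s)⁻¹ • ∫ y in s, (f x - f y) ∂μ := by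
    rw [integral_sub hc hf, smul_sub, ← setAverage_eq, ← setAverage_eq, setAverage_const h0 ht]
  have hinv : ‖(μ.real s)⁻¹‖ₑ = (μ s)⁻¹ := by
    rw [enorm_inv ((measureReal_ne_zero_iff ht).2 h0), Real.enorm_of_nonneg measureReal_nonneg,
      ofReal_measureReal ht]
  have hm : AEMeasurable (fun y => ‖f x - f y‖ₑ) (μ.restrict s) :=
    (hc.sub hf).aestronglyMeasurable.enorm
  calc ‖f x - ⨍ y in s, f y ∂μ‖ₑ ^ 2
      ≤ ((μ s)⁻¹ * ∫⁻ y in s, ‖f x - f y‖ₑ ∂μ) ^ 2 := by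
        rw [hsub, enorm_smul, hinv]
        gcongr
        exact enorm_integral_le_lintegral_enorm _
    _ ≤ (μ s)⁻¹ ^ 2 * (μ s * ∫⁻ y in s, ‖f x - f y‖ₑ ^ 2 ∂μ) := by
        rw [mul_pow]
        gcongr
        simpa using sq_lintegral_le (μ.restrict s) hm
    _ = (μ s)⁻¹ * ∫⁻ y in s, ‖f x - f y‖ₑ ^ 2 ∂μ := by
        rw [sq, mul_assoc, ← mul_assoc _ (μ s), ENNReal.inv_mul_cancel h0 ht, one_mul]

variable {E F : Type*} [NormedAddCommGroup E] [NormedSpace ℝ E] [FiniteDimensional ℝ E]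
  [MeasurableSpace E] [BorelSpace E] {μ : Measure E} [μ.IsAddHaarMeasure]
  [NormedAddCommGroup F] [NormedSpace ℝ F] [CompleteSpace F] {f : E → F} {Q : E → Set E} {r : ℝ}

theorem enorm_sub_setAverage_sq_le_lintegral_closedBall (hf : Continuous f) {x : E}
    (hQ : Q x ⊆ Metric.closedBall x r) (h0 : μ (Q x) ≠ 0) :
    ‖f x - ⨍ y in Q x, f y ∂μ‖ₑ ^ 2 ≤
      (μ (Q x))⁻¹ * ∫⁻ z in Metric.closedBall 0 r, ‖f (x + z) - f x‖ₑ ^ 2 ∂μ := by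
  have hQt : μ (Q x) ≠ ⊤ :=
    measure_ne_top_of_subset hQ (isCompact_closedBall x r).measure_ne_top
  have hfi : IntegrableOn f (Q x) μ :=
    (hf.continuousOn.integrableOn_compact (isCompact_closedBall x r)).mono_set hQ
  have hball : (x + ·) ⁻¹' Metric.closedBall x r = Metric.closedBall (0 : E) r := by
    simp [Metric.closedBall, dist_eq_norm, preimage]
  refine (enorm_sub_setAverage_sq_le hfi h0 hQt x).trans (mul_le_mul_right ?_ _)
  calc ∫⁻ y in Q x, ‖f x - f y‖ₑ ^ 2 ∂μ
      ≤ ∫⁻ y in Metric.closedBall x r, ‖f x - f y‖ₑ ^ 2 ∂μ := lintegral_mono_set hQ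
    _ = ∫⁻ z in Metric.closedBall 0 r, ‖f (x + z) - f x‖ₑ ^ 2 ∂μ := by
        rw [← (measurePreserving_add_left μ x).setLIntegral_comp_preimage_emb
          (measurableEmbedding_addLeft x), hball]
        simp only [enorm_sub_rev]

theorem lintegral_enorm_sub_setAverage_sq_le (hf : ContDiff ℝ 1 f)
    (hQ : ∀ x, Q x ⊆ Metric.closedBall x r) {v : ℝ≥0∞} (hv : v ≠ 0) (hμQ : ∀ x, μ (Q x) = v) :
    ∫⁻ x, ‖f x - ⨍ y in Q x, f y ∂μ‖ₑ ^ 2 ∂μ ≤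
      v⁻¹ * μ (Metric.closedBall 0 r) * (ENNReal.ofReal r ^ 2 * ∫⁻ x, ‖fderiv ℝ f x‖ₑ ^ 2 ∂μ) := by
  have hm : Measurable fun q : E × E => ‖f (q.1 + q.2) - f q.1‖ₑ ^ 2 := by
    have hc := hf.continuous
    have hsub : Continuous fun q : E × E => f (q.1 + q.2) - f q.1 := by fun_prop
    exact hsub.enorm.measurable.pow_const 2
  calc ∫⁻ x, ‖f x - ⨍ y in Q x, f y ∂μ‖ₑ ^ 2 ∂μ
      ≤ ∫⁻ x, v⁻¹ * (∫⁻ z in Metric.closedBall 0 r, ‖f (x + z) - f x‖ₑ ^ 2 ∂μ) ∂μ :=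
        lintegral_mono fun x => hμQ x ▸
          enorm_sub_setAverage_sq_le_lintegral_closedBall hf.continuous (hQ x) (hμQ x ▸ hv)
    _ = v⁻¹ * ∫⁻ z in Metric.closedBall 0 r, ∫⁻ x, ‖f (x + z) - f x‖ₑ ^ 2 ∂μ ∂μ := by
        rw [lintegral_const_mul _ hm.lintegral_prod_right, lintegral_lintegral_swap hm.aemeasurable]
    _ ≤ v⁻¹ * ∫⁻ _ in Metric.closedBall (0 : E) r,
          ENNReal.ofReal r ^ 2 * ∫⁻ x, ‖fderiv ℝ f x‖ₑ ^ 2 ∂μ ∂μ := by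
        refine mul_le_mul_right (setLIntegral_mono measurable_const fun z hz => ?_) _
        refine (lintegral_enorm_translate_sub_sq_le hf z).trans ?_
        gcongr
        rw [← ofReal_norm]
        exact ENNReal.ofReal_le_ofReal (by simpa using hz)
    _ = _ := by rw [setLIntegral_const, mul_comm (_ * _), mul_assoc]

end Averages

section Grid

variable {d : ℕ}

/-- The index of the cube of side length `h` in the grid `h ℤᵈ` that contains `x`. -/
def gridIndex (h : ℝ) (x : Space d) : Fin d → ℤ := fun i => ⌊x i / h⌋

/-- The half-open cube of side length `h` with index `m`, used for piecewise constant
approximation. -/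
def gridCell (h : ℝ) (m : Fin d → ℤ) : Set (Space d) := gridIndex h ⁻¹' {m}

theorem measurableSet_gridCell (h : ℝ) (m : Fin d → ℤ) : MeasurableSet (gridCell h m) := by
  have hmeas : Measurable (gridIndex h : Space d → Fin d → ℤ) :=
    measurable_pi_lambda _ fun i => Int.measurable_floor.comp
      ((by fun_prop : Measurable fun x : Space d => x i).div_const h)
  exact hmeas (measurableSet_singleton m)

theorem gridCell_eq_preimage_pi {h : ℝ} (hh : 0 < h) (m : Fin d → ℤ) :
    gridCell h m = (WithLp.ofLp : Space d → Fin d → ℝ) ⁻¹'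
      (univ.pi fun i => Ico (h * m i) (h * (m i + 1))) := by
  ext x
  simp only [gridCell, mem_singleton_iff, funext_iff, gridIndex, mem_preimage, mem_univ_pi,
    mem_Ico, Int.floor_eq_iff, le_div_iff₀ hh, div_lt_iff₀ hh, mul_comm h]

theorem volume_gridCell {h : ℝ} (hh : 0 < h) (m : Fin d → ℤ) :
    volume (gridCell h m) = ENNReal.ofReal h ^ d := by
  rw [gridCell_eq_preimage_pi hh, (PiLp.volume_preserving_ofLp (Fin d)).measure_preimage
    (MeasurableSet.univ_pi fun i => measurableSet_Ico).nullMeasurableSet, Real.volume_pi_Ico]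
  simp [mul_add]

theorem gridCell_gridIndex_subset_closedBall {h : ℝ} (hh : 0 < h) (x : Space d) :
    gridCell h (gridIndex h x) ⊆ Metric.closedBall x (h * √d) := by
  intro y hy
  have hx : x ∈ gridCell h (gridIndex h x) := rfl
  rw [gridCell_eq_preimage_pi hh] at hx hy
  have hcoord (i : Fin d) : dist (y i) (x i) ^ 2 ≤ h ^ 2 := by
    obtain ⟨hxl, hxu⟩ := hx i (mem_univ i)
    obtain ⟨hyl, hyu⟩ := hy i (mem_univ i)
    refine pow_le_pow_left₀ dist_nonneg ?_ 2
    rw [Real.dist_eq, abs_le]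
    constructor <;> linarith
  rw [Metric.mem_closedBall, EuclideanSpace.dist_eq]
  calc √(∑ i, dist (y i) (x i) ^ 2) ≤ √(∑ _i : Fin d, h ^ 2) :=
        Real.sqrt_le_sqrt (Finset.sum_le_sum fun i _ => hcoord i)
    _ = h * √d := by
        rw [Finset.sum_const, Finset.card_univ, Fintype.card_fin, nsmul_eq_mul, mul_comm,
          Real.sqrt_mul (by positivity), Real.sqrt_sq hh.le]

theorem finite_image_gridIndex {h : ℝ} (hh : 0 < h) {D : Set (Space d)}
    (hD : Bornology.IsBounded D) : (gridIndex h '' D).Finite := by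
  obtain ⟨r, hr⟩ := hD.subset_closedBall 0
  refine (Set.finite_Icc (fun _ : Fin d => ⌊-r / h⌋) (fun _ => ⌊r / h⌋)).subset ?_
  rintro _ ⟨x, hx, rfl⟩
  have hxr : ‖x‖ ≤ r := by simpa using hr hx
  have hcoord (i : Fin d) : -r ≤ x i ∧ x i ≤ r := abs_le.1 ((PiLp.norm_apply_le x i).trans hxr)
  exact ⟨fun i => Int.floor_le_floor (div_le_div_of_nonneg_right (hcoord i).1 hh.le),
    fun i => Int.floor_le_floor (div_le_div_of_nonneg_right (hcoord i).2 hh.le)⟩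

theorem exists_lintegral_enorm_sub_gridAverage_sq_le (d : ℕ) {F : Type*} [NormedAddCommGroup F]
    [NormedSpace ℝ F] [CompleteSpace F] :
    ∃ K : ℝ, 0 ≤ K ∧ ∀ h : ℝ, 0 < h → ∀ f : Space d → F, ContDiff ℝ 1 f →
      ∫⁻ x, ‖f x - ⨍ y in gridCell h (gridIndex h x), f y‖ₑ ^ 2 ≤
        ENNReal.ofReal (K * h) ^ 2 * ∫⁻ x, ‖fderiv ℝ f x‖ₑ ^ 2 := by
  set V : ℝ := √d ^ d * volume.real (Metric.ball (0 : Space d) 1) with hV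
  refine ⟨√V * √d, by positivity, fun h hh f hf => ?_⟩
  have hv0 : ENNReal.ofReal h ^ d ≠ 0 := pow_ne_zero _ (by simpa using hh)
  have hvt : ENNReal.ofReal h ^ d ≠ ⊤ := ENNReal.pow_ne_top ENNReal.ofReal_ne_top
  have hball : (ENNReal.ofReal h ^ d)⁻¹ * volume (Metric.closedBall (0 : Space d) (h * √d)) =
      ENNReal.ofReal V := by
    rw [Measure.addHaar_closedBall _ _ (by positivity), finrank_euclideanSpace_fin, mul_pow,
      ENNReal.ofReal_mul (by positivity), ENNReal.ofReal_pow hh.le, mul_assoc, ← mul_assoc,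
      ENNReal.inv_mul_cancel hv0 hvt, one_mul, hV, ENNReal.ofReal_mul (by positivity),
      ofReal_measureReal measure_ball_lt_top.ne]
  refine (lintegral_enorm_sub_setAverage_sq_le hf (gridCell_gridIndex_subset_closedBall hh) hv0
    fun x => volume_gridCell hh _).trans_eq ?_
  rw [hball, ← mul_assoc, ← ENNReal.ofReal_pow (by positivity),
    ← ENNReal.ofReal_pow (by positivity), ← ENNReal.ofReal_mul (by positivity), mul_pow, mul_pow,
    mul_pow, Real.sq_sqrt (x := V) (by positivity)]
  congr 2
  ring

end Grid

section StepFunctions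

theorem exists_finiteDimensional_forall_comp_ae_eq {α β : Type*} [MeasurableSpace α] (p : ℝ≥0∞)
    (μ : Measure α) [IsFiniteMeasure μ] {π : α → β} {s : Set β} (hs : s.Finite)
    (hπ : ∀ i ∈ s, MeasurableSet (π ⁻¹' {i})) (hπs : ∀ᵐ x ∂μ, π x ∈ s) :
    ∃ W : Submodule ℝ (Lp ℝ p μ), FiniteDimensional ℝ W ∧
      ∀ c : β → ℝ, ∃ w ∈ W, w =ᵐ[μ] c ∘ π := by
  classical
  have := hs.fintype
  let χ (i : s) : Lp ℝ p μ := indicatorConstLp p (hπ i i.2) (measure_ne_top μ _) 1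
  refine ⟨Submodule.span ℝ (range χ), .span_of_finite ℝ (finite_range χ), fun c =>
    ⟨∑ i : s, c i • χ i, Submodule.sum_mem _ fun i _ =>
      Submodule.smul_mem _ _ (Submodule.subset_span (mem_range_self i)), ?_⟩⟩
  have hχ : ∀ᵐ x ∂μ, ∀ i : s, (c i • χ i : Lp ℝ p μ) x = c i * (π ⁻¹' {↑i}).indicator 1 x := by
    refine ae_all_iff.2 fun i => ?_
    filter_upwards [Lp.coeFn_smul (c i) (χ i), indicatorConstLp_coeFn (p := p)
      (hs := hπ i i.2) (hμs := measure_ne_top μ _) (c := (1 : ℝ))] with x hsmul hind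
    rw [hsmul, Pi.smul_apply, smul_eq_mul, hind]
    rfl
  filter_upwards [Lp.coeFn_finsetSum Finset.univ fun i : s => c i • χ i, hχ, hπs] with x hsum hx hxs
  rw [hsum, Finset.sum_apply, Finset.sum_eq_single ⟨π x, hxs⟩ _ (by simp)]
  · exact (hx _).trans (by simp)
  · intro i _ hi
    have hne : π x ≠ i := fun h => hi (Subtype.ext h.symm)
    exact (hx i).trans (by simp [hne])

end StepFunctions

section SobolevSpace

theorem enorm_sq_eq_lintegral {α E : Type*} [MeasurableSpace α] {μ : Measure α}
    [NormedAddCommGroup E] {f : Lp E 2 μ} {g : α → E} (hfg : f =ᵐ[μ] g) :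
    ‖f‖ₑ ^ 2 = ∫⁻ x, ‖g x‖ₑ ^ 2 ∂μ := by
  rw [Lp.enorm_def, eLpNorm_congr_ae hfg]
  simpa using eLpNorm_nnreal_pow_eq_lintegral (f := g) (μ := μ) (p := 2) two_ne_zero

theorem norm_le_of_enorm_sq_le {E F : Type*} [NormedAddCommGroup E] [NormedAddCommGroup F]
    {x : E} {y : F} {C : ℝ} (hC : 0 ≤ C) (h : ‖x‖ₑ ^ 2 ≤ ENNReal.ofReal C ^ 2 * ‖y‖ₑ ^ 2) :
    ‖x‖ ≤ C * ‖y‖ := by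
  rw [← mul_pow, ENNReal.pow_le_pow_left_iff two_ne_zero, ← ofReal_norm, ← ofReal_norm,
    ← ENNReal.ofReal_mul hC] at h
  exact (ENNReal.ofReal_le_ofReal_iff (by positivity)).1 h

variable {d : ℕ} {D : Set (Space d)} {φ : Space d → ℝ}

namespace IsTestFunction

theorem eq_zero (hφ : IsTestFunction D φ) {x : Space d} (hx : x ∉ D) : φ x = 0 :=
  image_eq_zero_of_notMem_tsupport fun h => hx (hφ.2.2 h)

theorem contDiff_one (hφ : IsTestFunction D φ) : ContDiff ℝ 1 φ := hφ.1.of_le (by simp)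

theorem enorm_sq_gradient (hφ : IsTestFunction D φ) {g : L2Vec D}
    (hg : g =ᵐ[volume.restrict D] ∇ φ) : ‖g‖ₑ ^ 2 = ∫⁻ x, ‖fderiv ℝ φ x‖ₑ ^ 2 := by
  have hsupp : (fun x => ‖fderiv ℝ φ x‖ₑ ^ 2).support ⊆ D := fun x hx =>
    hφ.2.2 (support_fderiv_subset ℝ fun h => hx (by simp [← ofReal_norm, h]))
  rw [enorm_sq_eq_lintegral hg, ← setLIntegral_eq_of_support_subset hsupp]
  refine lintegral_congr fun x => ?_
  rw [gradient, LinearIsometryEquiv.enorm_map]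

end IsTestFunction

instance : CompleteSpace (H10 D) :=
  (testGraph D).isClosed_topologicalClosure.completeSpace_coe

/-- The inclusion of `H¹₀(D)` in `L²(D)`. -/
def inclusion (D : Set (Space d)) : H10 D →L[ℝ] L2 D :=
  (WithLp.fstL 2 ℝ (L2 D) (L2Vec D)).comp (H10 D).subtypeL

theorem continuous_fn : Continuous (fn : H10 D → L2 D) := (inclusion D).continuous

theorem continuous_grad : Continuous (grad : H10 D → L2Vec D) :=
  ((WithLp.sndL 2 ℝ (L2 D) (L2Vec D)).comp (H10 D).subtypeL).continuous

theorem norm_sq_eq (u : H10 D) : ‖u‖ ^ 2 = ‖fn u‖ ^ 2 + ‖grad u‖ ^ 2 :=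
  WithLp.prod_norm_sq_eq_of_L2 (u : H1Ambient D)

theorem norm_grad_le (u : H10 D) : ‖grad u‖ ≤ ‖u‖ :=
  (sq_le_sq₀ (norm_nonneg _) (norm_nonneg _)).1 (by linarith [norm_sq_eq u, sq_nonneg ‖fn u‖])

theorem dense_testGraph : Dense {u : H10 D | (u : H1Ambient D) ∈ testGraph D} := by
  have h : (testGraph D : Set (H1Ambient D)) ⊆ H10 D := (testGraph D).le_topologicalClosure
  refine Subtype.dense_iff.2 fun u hu => closure_mono (fun p hp => ?_) hu
  exact ⟨⟨p, h hp⟩, hp, rfl⟩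

theorem exists_norm_fn_le (hd : 1 ≤ d) (hD : Bornology.IsBounded D) :
    ∃ C : ℝ, ∀ u : H10 D, ‖fn u‖ ≤ C * ‖grad u‖ := by
  have : Nonempty (Fin d) := ⟨⟨0, hd⟩⟩
  obtain ⟨C, hC⟩ := exists_lintegral_enorm_sq_le_lintegral_fderiv (F := ℝ) volume hD
  refine ⟨C, fun u => ?_⟩
  have hclosed : IsClosed {u : H10 D | ‖fn u‖ ≤ C * ‖grad u‖} :=
    isClosed_le continuous_fn.norm (continuous_const.mul continuous_grad.norm)
  refine closure_minimal (fun u hu => ?_) hclosed (dense_testGraph u)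
  obtain ⟨φ, hφ, hfn, hgrad⟩ := hu
  refine norm_le_of_enorm_sq_le C.2 ?_
  calc ‖fn u‖ₑ ^ 2 = ∫⁻ x in D, ‖φ x‖ₑ ^ 2 := enorm_sq_eq_lintegral hfn
    _ ≤ ∫⁻ x, ‖φ x‖ₑ ^ 2 := setLIntegral_le_lintegral _ _
    _ ≤ C ^ 2 * ∫⁻ x, ‖fderiv ℝ φ x‖ₑ ^ 2 := hC φ hφ.contDiff_one fun x => hφ.eq_zero
    _ = ENNReal.ofReal C ^ 2 * ‖grad u‖ₑ ^ 2 := by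
        rw [← hφ.enorm_sq_gradient hgrad, ENNReal.ofReal_coe_nnreal]
        rfl

theorem isCompactOperator_inclusion (hDm : MeasurableSet D) (hDb : Bornology.IsBounded D) :
    IsCompactOperator (inclusion D) := by
  have : IsFiniteMeasure (volume.restrict D) := isFiniteMeasure_restrict.2 hDb.measure_lt_top.ne
  obtain ⟨K, hK, hgrid⟩ := exists_lintegral_enorm_sub_gridAverage_sq_le d (F := ℝ)
  refine isCompactOperator_of_dense_of_finiteDimensional dense_testGraph fun ε hε => ?_
  obtain ⟨h, hh, hKh⟩ : ∃ h : ℝ, 0 < h ∧ K * h ≤ ε := by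
    refine ⟨ε / (K + 1), by positivity, ?_⟩
    rw [mul_div_assoc', div_le_iff₀ (by positivity)]
    nlinarith
  obtain ⟨W, hW, hstep⟩ := exists_finiteDimensional_forall_comp_ae_eq 2 (volume.restrict D)
    (finite_image_gridIndex hh hDb) (fun m _ => measurableSet_gridCell h m)
    ((ae_restrict_mem hDm).mono fun x hx => mem_image_of_mem _ hx)
  refine ⟨W, hW, fun u ⟨φ, hφ, hfn, hgrad⟩ => ?_⟩
  obtain ⟨w, hwW, hw⟩ := hstep fun m => ⨍ y in gridCell h m, φ y
  refine ⟨w, hwW, ?_⟩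
  have hsub : (fn u - w : L2 D) =ᵐ[volume.restrict D]
      fun x => φ x - ⨍ y in gridCell h (gridIndex h x), φ y :=
    (Lp.coeFn_sub _ _).trans (hfn.sub hw)
  have hbound : ‖fn u - w‖ ≤ K * h * ‖grad u‖ := by
    refine norm_le_of_enorm_sq_le (by positivity) ?_
    rw [enorm_sq_eq_lintegral hsub, grad, hφ.enorm_sq_gradient hgrad]
    exact (setLIntegral_le_lintegral _ _).trans (hgrid h hh φ hφ.contDiff_one)
  exact hbound.trans (mul_le_mul hKh (norm_grad_le u) (norm_nonneg _) hε.le)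

end SobolevSpace

section InfiniteDimension

theorem exists_contDiff_kronecker {E : Type*} [NormedAddCommGroup E] [NormedSpace ℝ E]
    [FiniteDimensional ℝ E] {U : Set E} (hU : IsOpen U) {s : Finset E} (hs : ↑s ⊆ U)
    {x : E} (hx : x ∈ s) : ∃ ψ : E → ℝ, ContDiff ℝ ∞ ψ ∧ HasCompactSupport ψ ∧ tsupport ψ ⊆ U ∧
      ψ x = 1 ∧ ∀ y ∈ s, y ≠ x → ψ y = 0 := by
  classical
  have hnhds : U \ (s.erase x : Set E) ∈ nhds x :=
    (hU.sdiff (s.erase x).finite_toSet.isClosed).mem_nhds ⟨hs hx, by simp⟩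
  obtain ⟨ψ, hsupp, hcomp, hsmooth, -, hone⟩ := exists_contDiff_tsupport_subset (n := ⊤) hnhds
  exact ⟨ψ, hsmooth, hcomp, hsupp.trans sdiff_subset, hone, fun y hy hyx =>
    image_eq_zero_of_notMem_tsupport fun hmem => (hsupp hmem).2 (by simpa using ⟨hy, hyx⟩)⟩

theorem linearIndependent_of_ae_eq_of_kronecker {X ι : Type*} [TopologicalSpace X]
    [MeasurableSpace X] {μ : Measure X} [μ.IsOpenPosMeasure] {p : ℝ≥0∞} {U : Set X}
    (hU : IsOpen U) {f : ι → Lp ℝ p (μ.restrict U)} {ψ : ι → X → ℝ} {x : ι → X}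
    (hψ : ∀ i, Continuous (ψ i)) (hf : ∀ i, f i =ᵐ[μ.restrict U] ψ i) (hx : ∀ i, x i ∈ U)
    (hone : ∀ i, ψ i (x i) = 1) (hzero : ∀ i j, i ≠ j → ψ i (x j) = 0) :
    LinearIndependent ℝ f := by
  refine linearIndependent_iff'.2 fun s c hc j hj => ?_
  have hae : (fun y => ∑ i ∈ s, c i * ψ i y) =ᵐ[μ.restrict U] fun _ => 0 := by
    have hterm : ∀ᵐ y ∂(μ.restrict U), ∀ i ∈ s, (c i • f i : Lp ℝ p _) y = c i * ψ i y := by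
      refine (ae_ball_iff s.countable_toSet).2 fun i _ => ?_
      filter_upwards [Lp.coeFn_smul (c i) (f i), hf i] with y hsmul hfy
      rw [hsmul, Pi.smul_apply, hfy, smul_eq_mul]
    have hsum := Lp.coeFn_finsetSum s fun i => c i • f i
    rw [hc] at hsum
    filter_upwards [hsum, hterm, Lp.coeFn_zero ℝ p (μ.restrict U)] with y hsum hterm hzero
    rw [← Finset.sum_congr rfl hterm, ← Finset.sum_apply, ← hsum, hzero, Pi.zero_apply]
  have heq : ∑ i ∈ s, c i * ψ i (x j) = 0 :=
    Measure.eqOn_open_of_ae_eq hae hU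
      (continuous_finsetSum s fun i _ => continuous_const.mul (hψ i)).continuousOn
      continuousOn_const (hx j)
  rwa [Finset.sum_eq_single_of_mem j hj fun i _ hij => by rw [hzero i j hij, mul_zero], hone,
    mul_one] at heq

variable {d : ℕ} {D : Set (Space d)}

theorem IsTestFunction.exists_fn_ae_eq {φ : Space d → ℝ} (hφ : IsTestFunction D φ) :
    ∃ u : H10 D, fn u =ᵐ[volume.restrict D] φ := by
  have hcont : Continuous (∇ φ) :=
    (InnerProductSpace.toDual ℝ (Space d)).symm.continuous.comp
      (hφ.contDiff_one.continuous_fderiv one_ne_zero)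
  have hsupp : HasCompactSupport (∇ φ) := (hφ.2.1.fderiv (𝕜 := ℝ)).comp_left (map_zero _)
  have hφL := (hφ.1.continuous.memLp_of_hasCompactSupport (μ := volume) (p := 2) hφ.2.1).restrict D
  have hgL := (hcont.memLp_of_hasCompactSupport (μ := volume) (p := 2) hsupp).restrict D
  refine ⟨⟨WithLp.toLp 2 (hφL.toLp φ, hgL.toLp (∇ φ)), ?_⟩, hφL.coeFn_toLp⟩
  exact (testGraph D).le_topologicalClosure ⟨φ, hφ, hφL.coeFn_toLp, hgL.coeFn_toLp⟩

theorem not_finiteDimensional_range_inclusion (hd : 1 ≤ d) (hDo : IsOpen D) (hDn : D.Nonempty) :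
    ¬ FiniteDimensional ℝ (inclusion D).range := by
  intro hfin
  have : Nonempty (Fin d) := ⟨⟨0, hd⟩⟩
  obtain ⟨x₀, hx₀⟩ := hDn
  obtain ⟨s, hsD, hcard⟩ := (infinite_of_mem_nhds x₀ (hDo.mem_nhds hx₀)).exists_subset_card_eq
    (Module.finrank ℝ (inclusion D).range + 1)
  choose ψ hsmooth hcomp hsupp hone hzero using
    fun x : s => exists_contDiff_kronecker hDo hsD x.2
  choose u hu using fun x => IsTestFunction.exists_fn_ae_eq ⟨hsmooth x, hcomp x, hsupp x⟩
  have hli : LinearIndependent ℝ fun x => fn (u x) :=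
    linearIndependent_of_ae_eq_of_kronecker hDo (fun x => (hsmooth x).continuous) hu
      (fun x => hsD x.2) hone fun x y hxy => hzero x y y.2 fun h => hxy (Subtype.ext h.symm)
  let f (x : s) : (inclusion D).range := ⟨fn (u x), u x, rfl⟩
  have hle := (LinearIndependent.of_comp (inclusion D).range.subtype (v := f)
    hli).fintype_card_le_finrank
  rw [Fintype.card_coe, hcard] at hle
  omega

end InfiniteDimension

section EnergyForms

variable {d : ℕ} {D : Set (Space d)}

theorem isEnergyForm_of_bounds (hd : 1 ≤ d) (hDb : Bornology.IsBounded D)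
    {B : LinearMap.BilinForm ℝ (H10 D)} (hsymm : ∀ u v, B u v = B v u) {c C : ℝ} (hc : 0 < c)
    (hlow : ∀ u, c * ‖grad u‖ ^ 2 ≤ B u u) (hup : ∀ u, B u u ≤ C * ‖grad u‖ ^ 2) :
    IsEnergyForm B where
  symm := hsymm
  bounded := ⟨|C|, fun u => (hup u).trans <| by
    have := norm_grad_le u
    gcongr
    exact le_abs_self C⟩
  coercive := by
    obtain ⟨K, hK⟩ := exists_norm_fn_le hd hDb
    refine ⟨c / (K ^ 2 + 1), by positivity, fun u => le_trans ?_ (hlow u)⟩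
    have hfn : ‖fn u‖ ^ 2 ≤ (K * ‖grad u‖) ^ 2 := pow_le_pow_left₀ (norm_nonneg _) (hK u) 2
    rw [div_mul_eq_mul_div, div_le_iff₀ (by positivity), mul_assoc, norm_sq_eq]
    refine mul_le_mul_of_nonneg_left ?_ hc.le
    linarith

theorem dirichletForm_self (u : H10 D) : dirichletForm D u u = ‖grad u‖ ^ 2 :=
  real_inner_self_eq_norm_sq (grad u)

theorem isEnergyForm_dirichletForm (hd : 1 ≤ d) (hDb : Bornology.IsBounded D) :
    IsEnergyForm (dirichletForm D) :=
  isEnergyForm_of_bounds hd hDb (fun u v => real_inner_comm (grad v) (grad u)) one_pos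
    (fun u => (one_mul _).trans_le (dirichletForm_self u).ge)
    (fun u => (dirichletForm_self u).trans_le (one_mul _).ge)

theorem diffusionForm_apply (a : Linf D) (u v : H10 D) :
    diffusionForm a u v = ∫ x in D, a x * inner ℝ (grad u x) (grad v x) := rfl

theorem diffusionForm_symm (a : Linf D) (u v : H10 D) :
    diffusionForm a u v = diffusionForm a v u := by
  simp_rw [diffusionForm_apply, real_inner_comm]

theorem diffusionForm_zero_self (u : H10 D) : diffusionForm (0 : Linf D) u u = 0 := by
  rw [diffusionForm_apply]
  refine integral_eq_zero_of_ae ?_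
  filter_upwards [Lp.coeFn_zero ℝ ∞ (volume.restrict D)] with x hx
  exact mul_eq_zero_of_left hx _

theorem diffusionForm_self_le_add {a b : Linf D} {t : ℝ}
    (h : ∀ᵐ x ∂(volume.restrict D), a x ≤ b x + t) (u : H10 D) :
    diffusionForm a u u ≤ diffusionForm b u u + t * ‖grad u‖ ^ 2 := by
  have hb := integrable_coeff_mul_inner b (grad u) (grad u)
  have ht := (L2.integrable_inner (𝕜 := ℝ) (grad u) (grad u)).const_mul t
  have hgrad : ∫ x in D, inner ℝ (grad u x) (grad u x) = ‖grad u‖ ^ 2 := dirichletForm_self u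
  rw [diffusionForm_apply, diffusionForm_apply, ← hgrad, ← integral_const_mul,
    ← integral_add hb ht]
  refine integral_mono_ae (integrable_coeff_mul_inner a _ _) (hb.add ht) ?_
  filter_upwards [h] with x hx
  rw [← add_mul]
  exact mul_le_mul_of_nonneg_right hx real_inner_self_nonneg

theorem diffusionForm_self_le {a : Linf D} {C : ℝ} (ha : ∀ᵐ x ∂(volume.restrict D), a x ≤ C)
    (u : H10 D) : diffusionForm a u u ≤ C * ‖grad u‖ ^ 2 := by
  have h : ∀ᵐ x ∂(volume.restrict D), a x ≤ (0 : Linf D) x + C := by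
    filter_upwards [ha, Lp.coeFn_zero ℝ ∞ (volume.restrict D)] with x hx h0
    rwa [h0, Pi.zero_apply, zero_add]
  simpa [diffusionForm_zero_self] using diffusionForm_self_le_add h u

theorem le_diffusionForm_self {a : Linf D} {c : ℝ} (ha : ∀ᵐ x ∂(volume.restrict D), c ≤ a x)
    (u : H10 D) : c * ‖grad u‖ ^ 2 ≤ diffusionForm a u u := by
  have h : ∀ᵐ x ∂(volume.restrict D), (0 : Linf D) x ≤ a x + -c := by
    filter_upwards [ha, Lp.coeFn_zero ℝ ∞ (volume.restrict D)] with x hx h0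
    rwa [h0, Pi.zero_apply, le_add_neg_iff_add_le, zero_add]
  linarith [diffusionForm_self_le_add h u, diffusionForm_zero_self u]

theorem isEnergyForm_diffusionForm (hd : 1 ≤ d) (hDb : Bornology.IsBounded D) {a : Linf D}
    {c C : ℝ} (hc : 0 < c) (ha : ∀ᵐ x ∂(volume.restrict D), c ≤ a x ∧ a x ≤ C) :
    IsEnergyForm (diffusionForm a) :=
  isEnergyForm_of_bounds hd hDb (diffusionForm_symm a) hc
    (le_diffusionForm_self (ha.mono fun _ h => h.1))
    (diffusionForm_self_le (ha.mono fun _ h => h.2))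

end EnergyForms

section EigenvalueBounds

variable {d : ℕ} {D : Set (Space d)}

theorem eigenspace_eq_weakEigenspace (B : LinearMap.BilinForm ℝ (H10 D)) (t : ℝ) :
    eigenspace B t = weakEigenspace (inclusion D) B t := rfl

theorem eigenvalue_eq_weakEigenvalue (B : LinearMap.BilinForm ℝ (H10 D)) :
    eigenvalue B = weakEigenvalue (inclusion D) B := rfl

theorem isOrderedEigenvalues_eigenvalue (hd : 1 ≤ d) (hDo : IsOpen D)
    (hDb : Bornology.IsBounded D) (hDn : D.Nonempty) {B : LinearMap.BilinForm ℝ (H10 D)}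
    (hB : IsEnergyForm B) : IsOrderedEigenvalues B (eigenvalue B) := by
  have hι := isCompactOperator_inclusion hDo.measurableSet hDb
  have hinf := not_finiteDimensional_range_inclusion hd hDo hDn
  rw [eigenvalue_eq_weakEigenvalue]
  refine ⟨weakEigenvalue_pos hB hι hinf le_rfl,
    fun k hk => weakEigenvalue_mono hB hι hinf hk k.le_succ, fun t => ?_⟩
  rw [eigenspace_eq_weakEigenspace]
  exact encard_weakEigenvalue_eq hB hι hinf t

theorem eigenvalue_le_mul (hd : 1 ≤ d) (hDo : IsOpen D) (hDb : Bornology.IsBounded D)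
    (hDn : D.Nonempty) {B B' : LinearMap.BilinForm ℝ (H10 D)} (hB : IsEnergyForm B)
    (hB' : IsEnergyForm B') {k : ℕ} (hk : 1 ≤ k) {c : ℝ} (hc : 0 ≤ c)
    (hle : ∀ u, B u u ≤ c * B' u u) : eigenvalue B k ≤ c * eigenvalue B' k :=
  weakEigenvalue_le_mul hB hB' (isCompactOperator_inclusion hDo.measurableSet hDb)
    (not_finiteDimensional_range_inclusion hd hDo hDn) hk hc hle

theorem ae_abs_sub_le_norm_sub (a b : Linf D) :
    ∀ᵐ x ∂(volume.restrict D), |a x - b x| ≤ ‖a - b‖ := by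
  filter_upwards [Lp.coeFn_sub a b, ae_le_eLpNormEssSup (f := ⇑(a - b))] with x hsub hx
  rwa [← eLpNorm_exponent_top, ← Lp.enorm_def, enorm_le_iff_norm_le, hsub] at hx

theorem eigenvalue_diffusionForm_sub_le (hd : 1 ≤ d) (hDo : IsOpen D)
    (hDb : Bornology.IsBounded D) (hDn : D.Nonempty) {a b : Linf D} {c C : ℝ} (hc : 0 < c)
    (hC : 0 ≤ C) (ha : ∀ᵐ x ∂(volume.restrict D), c ≤ a x ∧ a x ≤ C)
    (hb : ∀ᵐ x ∂(volume.restrict D), c ≤ b x ∧ b x ≤ C) {k : ℕ} (hk : 1 ≤ k) :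
    eigenvalue (diffusionForm a) k - eigenvalue (diffusionForm b) k ≤
      C * chi D k / c * ‖a - b‖ := by
  have hA := isEnergyForm_diffusionForm hd hDb hc ha
  have hB := isEnergyForm_diffusionForm hd hDb hc hb
  have hab : ∀ᵐ x ∂(volume.restrict D), a x ≤ b x + ‖a - b‖ := by
    filter_upwards [ae_abs_sub_le_norm_sub a b] with x hx
    linarith [le_abs_self (a x - b x)]
  have hrel : eigenvalue (diffusionForm a) k ≤
      (1 + ‖a - b‖ / c) * eigenvalue (diffusionForm b) k := by
    refine eigenvalue_le_mul hd hDo hDb hDn hA hB hk (by positivity) fun u => ?_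
    calc diffusionForm a u u
        ≤ diffusionForm b u u + ‖a - b‖ / c * (c * ‖grad u‖ ^ 2) := by
          rw [← mul_assoc, div_mul_cancel₀ _ hc.ne']
          exact diffusionForm_self_le_add hab u
      _ ≤ diffusionForm b u u + ‖a - b‖ / c * diffusionForm b u u := by
          gcongr
          exact le_diffusionForm_self (hb.mono fun _ h => h.1) u
      _ = (1 + ‖a - b‖ / c) * diffusionForm b u u := by ring
  have hchi : eigenvalue (diffusionForm b) k ≤ C * chi D k :=
    eigenvalue_le_mul hd hDo hDb hDn hB (isEnergyForm_dirichletForm hd hDb) hk hC fun u => by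
      rw [dirichletForm_self]
      exact diffusionForm_self_le (hb.mono fun _ h => h.2) u
  calc eigenvalue (diffusionForm a) k - eigenvalue (diffusionForm b) k
      ≤ ‖a - b‖ / c * eigenvalue (diffusionForm b) k := by linarith
    _ ≤ ‖a - b‖ / c * (C * chi D k) := by gcongr
    _ = C * chi D k / c * ‖a - b‖ := by ring

theorem abs_eigenvalue_diffusionForm_sub_le (hd : 1 ≤ d) (hDo : IsOpen D)
    (hDb : Bornology.IsBounded D) (hDn : D.Nonempty) {a b : Linf D} {c C : ℝ} (hc : 0 < c)
    (ha : ∀ᵐ x ∂(volume.restrict D), c ≤ a x ∧ a x ≤ C)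
    (hb : ∀ᵐ x ∂(volume.restrict D), c ≤ b x ∧ b x ≤ C) {k : ℕ} (hk : 1 ≤ k) :
    |eigenvalue (diffusionForm a) k - eigenvalue (diffusionForm b) k| ≤
      C ^ 2 * chi D k ^ 2 / (c ^ 2 * chi D 1) * ‖a - b‖ := by
  have hcC : c ≤ C := by
    have : (ae (volume.restrict D)).NeBot :=
      ae_neBot.2 (Measure.restrict_eq_zero.not.2 (hDo.measure_ne_zero volume hDn))
    obtain ⟨x, hcx, hxC⟩ := ha.exists
    exact hcx.trans hxC
  have hC : 0 < C := hc.trans_le hcC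
  have hE := isEnergyForm_dirichletForm hd hDb
  have hι := isCompactOperator_inclusion hDo.measurableSet hDb
  have hinf := not_finiteDimensional_range_inclusion hd hDo hDn
  have hpos : 0 < chi D 1 := weakEigenvalue_pos hE hι hinf le_rfl
  have hmono : chi D 1 ≤ chi D k := weakEigenvalue_mono hE hι hinf le_rfl hk
  have hratio : 1 ≤ C * chi D k / (c * chi D 1) := by
    rw [one_le_div (by positivity)]
    gcongr
  have hsub : |eigenvalue (diffusionForm a) k - eigenvalue (diffusionForm b) k| ≤
      C * chi D k / c * ‖a - b‖ :=
    abs_sub_le_iff.2 ⟨eigenvalue_diffusionForm_sub_le hd hDo hDb hDn hc hC.le ha hb hk,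
      norm_sub_rev a b ▸ eigenvalue_diffusionForm_sub_le hd hDo hDb hDn hc hC.le hb ha hk⟩
  have hnonneg : 0 ≤ C * chi D k / c * ‖a - b‖ := (abs_nonneg _).trans hsub
  calc |eigenvalue (diffusionForm a) k - eigenvalue (diffusionForm b) k|
      ≤ C * chi D k / (c * chi D 1) * (C * chi D k / c * ‖a - b‖) :=
        hsub.trans (le_mul_of_one_le_left hnonneg hratio)
    _ = C ^ 2 * chi D k ^ 2 / (c ^ 2 * chi D 1) * ‖a - b‖ := by
        field_simp

end EigenvalueBounds

section Coefficients

theorem summable_of_summable_rpow {ι : Type*} {f : ι → ℝ} (hf : ∀ j, 0 ≤ f j) {p : ℝ}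
    (hp : 0 < p) (hp1 : p ≤ 1) (h : Summable fun j => f j ^ p) : Summable f := by
  have hmem : Memℓp f (ENNReal.ofReal p) := memℓp_gen (by
    simpa [ENNReal.toReal_ofReal hp.le, abs_of_nonneg (hf _)] using h)
  simpa [abs_of_nonneg (hf _)] using
    (hmem.of_exponent_ge (ENNReal.ofReal_le_one.2 hp1)).summable (by simp)

variable {d : ℕ} {D : Set (Space d)} {a : ℕ → Linf D}

theorem norm_coeff_sub_le (ha : Summable fun j : ℕ => ‖a (j + 1)‖) (y y' : SeqInf) :
    ‖coeff a y - coeff a y'‖ ≤ (∑' j : ℕ, ‖a (j + 1)‖) * ‖y - y'‖ := by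
  have hterm (z : SeqInf) (j : ℕ) : ‖z j • a (j + 1)‖ ≤ ‖a (j + 1)‖ * ‖z‖ := by
    rw [norm_smul, mul_comm]
    gcongr
    exact lp.norm_apply_le_norm ENNReal.top_ne_zero z j
  have hsum (z : SeqInf) : Summable fun j : ℕ => z j • a (j + 1) :=
    .of_norm_bounded (ha.mul_right ‖z‖) (hterm z)
  rw [coeff, coeff, add_sub_add_left_eq_sub, ← (hsum y).tsum_sub (hsum y'), ← tsum_mul_right]
  refine tsum_of_norm_bounded (ha.mul_right _).hasSum fun j => ?_
  rw [← sub_smul]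
  exact hterm (y - y') j

end Coefficients

end EllipticEVP

end

open EllipticEVP in
theorem proposition2p2_general {d : ℕ} (hd : 1 ≤ d) (D : Set (Space d)) (hD_open : IsOpen D)
    (hD_bdd : Bornology.IsBounded D) (hD_ne : D.Nonempty) (a : ℕ → Linf D)
    (ha : Summable fun j : ℕ => ‖a (j + 1)‖) {amin amax : ℝ} (hmin : 0 < amin) {U : Set SeqInf}
    (hU : ∀ y ∈ U, ∀ᵐ x ∂(volume.restrict D), amin ≤ coeff a y x ∧ coeff a y x ≤ amax) :
    IsOrderedEigenvalues (dirichletForm D) (chi D) ∧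
    (∀ y ∈ U, IsOrderedEigenvalues (diffusionForm (coeff a y)) (fun k => lam a k y)) ∧
    ∀ k : ℕ, 1 ≤ k →
      (∃ C : ℝ≥0, LipschitzOnWith C (lam a k) U) ∧
      ∀ y ∈ U, ∀ y' ∈ U,
        |lam a k y - lam a k y'| ≤
            amax ^ 2 * chi D k ^ 2 / (amin ^ 2 * chi D 1) * ‖coeff a y - coeff a y'‖ ∧
        amax ^ 2 * chi D k ^ 2 / (amin ^ 2 * chi D 1) * ‖coeff a y - coeff a y'‖ ≤
            amax ^ 2 * chi D k ^ 2 / (amin ^ 2 * chi D 1) * (∑' j : ℕ, ‖a (j + 1)‖) *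
              ‖y - y'‖ := by
  have hchi : IsOrderedEigenvalues (dirichletForm D) (chi D) :=
    isOrderedEigenvalues_eigenvalue hd hD_open hD_bdd hD_ne (isEnergyForm_dirichletForm hd hD_bdd)
  refine ⟨hchi, fun y hy => isOrderedEigenvalues_eigenvalue hd hD_open hD_bdd hD_ne
    (isEnergyForm_diffusionForm hd hD_bdd hmin (hU y hy)), fun k hk => ?_⟩
  set K := amax ^ 2 * chi D k ^ 2 / (amin ^ 2 * chi D 1)
  have hK : 0 ≤ K := by
    have := hchi.pos
    positivity
  have hlam {y y' : SeqInf} (hy : y ∈ U) (hy' : y' ∈ U) :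
      |lam a k y - lam a k y'| ≤ K * ‖coeff a y - coeff a y'‖ :=
    abs_eigenvalue_diffusionForm_sub_le hd hD_open hD_bdd hD_ne hmin (hU y hy) (hU y' hy') hk
  have hcoeff (y y' : SeqInf) :
      K * ‖coeff a y - coeff a y'‖ ≤ K * (∑' j : ℕ, ‖a (j + 1)‖) * ‖y - y'‖ := by
    rw [mul_assoc]
    exact mul_le_mul_of_nonneg_left (norm_coeff_sub_le ha y y') hK
  have hS : 0 ≤ ∑' j : ℕ, ‖a (j + 1)‖ := tsum_nonneg fun _ => norm_nonneg _
  refine ⟨⟨⟨_, mul_nonneg hK hS⟩, LipschitzOnWith.of_dist_le_mul fun y hy y' hy' => ?_⟩,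
    fun y hy y' hy' => ⟨hlam hy hy', hcoeff y y'⟩⟩
  rw [Real.dist_eq, dist_eq_norm]
  exact (hlam hy hy').trans (hcoeff y y')

theorem proposition2p2 {d : ℕ} (hd : 1 ≤ d) (D : Set (EllipticEVP.Space d))
    (hD_open : IsOpen D) (hD_bdd : Bornology.IsBounded D) (hD_ne : D.Nonempty)
    (a : ℕ → EllipticEVP.Linf D) (amin amax p : ℝ)
    (hA : EllipticEVP.CoeffAssumption a amin amax p) :
    -- the eigenvalues are well defined and ordered
    EllipticEVP.IsOrderedEigenvalues (EllipticEVP.dirichletForm D) (EllipticEVP.chi D) ∧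
    (∀ y ∈ EllipticEVP.paramDomain,
      EllipticEVP.IsOrderedEigenvalues (EllipticEVP.diffusionForm (EllipticEVP.coeff a y))
        (fun k => EllipticEVP.lam a k y)) ∧
    -- the sum in the Lipschitz constant is finite
    (Summable fun j : ℕ => ‖a (j + 1)‖) ∧
    ∀ k : ℕ, 1 ≤ k →
      -- Lipschitz continuity in the metric of `ℓ^∞`
      (∃ C : ℝ≥0, LipschitzOnWith C (EllipticEVP.lam a k) EllipticEVP.paramDomain) ∧
      -- the explicit bounds
      ∀ y ∈ EllipticEVP.paramDomain, ∀ y' ∈ EllipticEVP.paramDomain,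
        |EllipticEVP.lam a k y - EllipticEVP.lam a k y'| ≤
            amax ^ 2 * EllipticEVP.chi D k ^ 2 / (amin ^ 2 * EllipticEVP.chi D 1) *
              ‖EllipticEVP.coeff a y - EllipticEVP.coeff a y'‖ ∧
        amax ^ 2 * EllipticEVP.chi D k ^ 2 / (amin ^ 2 * EllipticEVP.chi D 1) *
              ‖EllipticEVP.coeff a y - EllipticEVP.coeff a y'‖ ≤
            amax ^ 2 * EllipticEVP.chi D k ^ 2 / (amin ^ 2 * EllipticEVP.chi D 1) *
              (∑' j : ℕ, ‖a (j + 1)‖) * ‖y - y'‖ := by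
  have hsum := EllipticEVP.summable_of_summable_rpow (fun _ => norm_nonneg _) hA.p_pos
    hA.p_lt_one.le hA.summable
  have ⟨hchi, hlam, hlip⟩ := proposition2p2_general hd D hD_open hD_bdd hD_ne a hsum
    hA.amin_pos hA.bounds
  exact ⟨hchi, hlam, hsum, hlip⟩
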